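/- Let $(\widetilde M^{2n},J,g)$ be a locally conformal K\"ahler manifold: $g$ is Hermitian and every point has an open neighbourhood $U$ with a smooth $f:U\to\mathbb R$ such that $e^{-f}g$ is K\"ahler on $U$. Let $\omega$ be the Lee form ($\omega=df$ on each such $U$) and $B$ the Lee vector field, $g(B,\cdot)=\omega$. Let $(M_{\theta_1},g_1)$ and $(M_{\theta_2},g_2)$ be Riemannian manifolds of dimensions $2n_1$ and $2n_2$, $\lambda:M_{\theta_1}\to(0,\infty)$ a smooth function, and let $M=M_{\theta_1}\times_\lambda M_{\theta_2}$, the product manifold with the metric $\pi_1^*g_1+\lambda^2\pi_2^*g_2$, be isometrically immersed in $\widetilde M$. Put $\mathcal D^{\theta_1}=T(M_{\theta_1}\times\{q\})$ and $\mathcal D^{\theta_2}=T(\{p\}\times M_{\theta_2})$ at $(p,q)\in M$. For $U\in TM$ write $JU=PU+FU$ with $PU$ tangent and $FU$ normal to $M$. Suppose that $M$ is pointwise bi-slant with slant functions $\theta_1:M_{\theta_1}\to(0,\frac{\pi}{2})$ and $\theta_2:M_{\theta_2}\to(0,\frac{\pi}{2})$ of the two factors, where $\theta_1\neq\theta_2$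 at every point of $M$; that is, $P^2X=-\cos^2\theta_1\,X$ for $X\in\mathcal D^{\theta_1}$ and $P^2Z=-\cos^2\theta_2\,Z$ for $Z\in\mathcal D^{\theta_2}$. Let $h$ be the second fundamental form of $M$, $\|h\|^2=\sum_{i,j}\|h(e_i,e_j)\|^2$ for an orthonormal basis $(e_i)$ of the tangent space of $M$, let $H=\operatorname{trace}h$ be the mean curvature vector, let $H_{\mathcal D^{\theta_i}}$ be the trace of $h$ over $\mathcal D^{\theta_i}$, and let $\xi|_W$ denote the orthogonal projection of $\xi$ onto $W$. Then at every point of $M$ $$\|h\|^2\ \ge\ \tfrac{n_1}{2}\sin^2\theta_2\,\bigl\|B|_{F\mathcal D^{\theta_2}}\bigr\|^2+\tfrac{n_2}{2}\sin^2\theta_1\,\bigl\|B|_{F\mathcal D^{\theta_1}}\bigr\|^2+\sin\theta_2\, g\bigl(H_{\mathcal D^{\theta_1}}|_{F\mathcal D^{\theta_2}},B|_{F\mathcal D^{\theta_2}}\bigr)+\sin\theta_1\, g\bigl(H_{\mathcal D^{\theta_2}}|_{F\mathcal D^{\theta_1}},B|_{F\mathcal D^{\theta_1}}\bigr).$$ At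 every point where equality holds, the image of $h$ is contained in $F\mathcal D^{\theta_1}\oplus F\mathcal D^{\theta_2}$. If equality holds at all points of $M$, then $M$ is minimal ($H=0$) if and only if $M$ is mixed totally geodesic ($h(\mathcal D^{\theta_1},\mathcal D^{\theta_2})=0$). -/

import Mathlib

open Set Module
open scoped Manifold ContDiff Topology Bundle

noncomputable section

namespace LCK

/-! ### Linear algebra of a Euclidean vector space `(V, β)` -/

section LinearAlgebra

variable {V : Type*} [AddCommGroup V] [Module ℝ V]

/-- `β` is an inner product. -/
def IsInnerProduct (β : LinearMap.BilinForm ℝ V) : Prop :=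
  (∀ u v, β u v = β v u) ∧ ∀ v, v ≠ 0 → 0 < β v v

open Classical in
/-- The vector `w` representing the functional `α`, i.e. `β w v = α v` for all `v`. It exists and is
unique when `β` is an inner product on a finite-dimensional space, see `riesz_apply`. -/
def riesz (β : LinearMap.BilinForm ℝ V) (α : V →ₗ[ℝ] ℝ) : V :=
  if h : ∃ w, ∀ v, β w v = α v then h.choose else 0

theorem riesz_apply [FiniteDimensional ℝ V] {β : LinearMap.BilinForm ℝ V} (hβ : IsInnerProduct β)
    (α : V →ₗ[ℝ] ℝ) (v : V) : β (riesz β α) v = α v := by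
  have hinj : Function.Injective β := by
    rw [← LinearMap.ker_eq_bot, LinearMap.ker_eq_bot']
    intro w hw
    by_contra hne
    have := hβ.2 w hne
    simp [hw] at this
  have hsurj : Function.Surjective β :=
    (LinearMap.injective_iff_surjective_of_finrank_eq_finrank
      (Subspace.dual_finrank_eq (K := ℝ) (V := V)).symm).1 hinj
  obtain ⟨w, hw⟩ := hsurj α
  have h : ∃ w, ∀ v, β w v = α v := ⟨w, fun v => by rw [hw]⟩
  unfold riesz
  rw [dif_pos h]
  exact h.choose_spec v

/-- The `β`-orthogonal projection of `v` onto the subspace `W`, also written `v|_W`. -/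
def proj (β : LinearMap.BilinForm ℝ V) (W : Submodule ℝ V) (v : V) : V :=
  (riesz (β.restrict W) ((β v) ∘ₗ W.subtype) : W)

theorem proj_mem (β : LinearMap.BilinForm ℝ V) (W : Submodule ℝ V) (v : V) : proj β W v ∈ W :=
  Subtype.property _

theorem proj_apply [FiniteDimensional ℝ V] {β : LinearMap.BilinForm ℝ V} (hβ : IsInnerProduct β)
    (W : Submodule ℝ V) (v : V) {w : V} (hw : w ∈ W) : β (proj β W v) w = β v w := by
  have h : IsInnerProduct (β.restrict W) :=
    ⟨fun x y => hβ.1 x y, fun x hx => hβ.2 x (by simpa using hx)⟩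
  exact riesz_apply h ((β v) ∘ₗ W.subtype) ⟨w, hw⟩

/-- The finite family `e` is a `β`-orthonormal basis of the subspace `W`. -/
def IsOrthonormalBasis (β : LinearMap.BilinForm ℝ V) (W : Submodule ℝ V)
    (e : Fin (finrank ℝ W) → V) : Prop :=
  (∀ i, e i ∈ W) ∧ ∀ i j, β (e i) (e j) = if i = j then 1 else 0

open Classical in
/-- A `β`-orthonormal basis of `W`, see `frame_spec`. -/
def frame (β : LinearMap.BilinForm ℝ V) (W : Submodule ℝ V) : Fin (finrank ℝ W) → V :=
  if h : ∃ e, IsOrthonormalBasis β W e then h.choose else 0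

theorem frame_spec [FiniteDimensional ℝ V] {β : LinearMap.BilinForm ℝ V} (hβ : IsInnerProduct β)
    (W : Submodule ℝ V) : IsOrthonormalBasis β W (frame β W) := by
  have h : ∃ e, IsOrthonormalBasis β W e := by
    let γ := β.restrict W
    let core : InnerProductSpace.Core ℝ W :=
      { inner := fun x y => β x y
        conj_inner_symm := fun x y => by simpa using hβ.1 y x
        re_inner_nonneg := fun x => by
          by_cases hx : (x : V) = 0
          · simp [hx]
          · simpa using (hβ.2 x hx).le
        add_left := fun x y z => by simp
        smul_left := fun x y r => by simp
        definite := fun x hx => by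
          by_contra hne
          exact (hβ.2 (x : V) (by simpa using hne)).ne' hx }
    let _ : NormedAddCommGroup W := core.toNormedAddCommGroup
    let _ : InnerProductSpace ℝ W := InnerProductSpace.ofCore core.toCore
    let b := stdOrthonormalBasis ℝ W
    refine ⟨fun i => b i, fun i => (b i).2, fun i j => ?_⟩
    exact orthonormal_iff_ite.1 b.orthonormal i j
  unfold frame
  rw [dif_pos h]
  exact h.choose_spec

variable {V' : Type*} [AddCommGroup V'] [Module ℝ V']

/-- The trace of a bilinear map `b` over the subspace `W`: the sum of `b (eᵢ, eᵢ)` over an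
orthonormal basis of `W`. -/
def traceOn (β : LinearMap.BilinForm ℝ V) (W : Submodule ℝ V) (b : V → V → V') : V' :=
  ∑ i, b (frame β W i) (frame β W i)

/-- The squared norm of a bilinear map `b` with values in `(V', β')`: the sum of
`|b (eᵢ, eⱼ)|²` over all pairs of members of an orthonormal basis of `V`. -/
def normSq (β : LinearMap.BilinForm ℝ V) (β' : LinearMap.BilinForm ℝ V') (b : V → V → V') : ℝ :=
  ∑ i, ∑ j, β' (b (frame β ⊤ i) (frame β ⊤ j)) (b (frame β ⊤ i) (frame β ⊤ j))

end LinearAlgebra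

/-! ### Riemannian and almost Hermitian geometry in the preferred charts

Near a point `x` the tangent spaces are identified with the model space `E` by the coordinate frame
of the preferred chart at `x`. At `x` itself this is the identification of the tangent space
with `E` that Mathlib uses as definition. -/

section Ambient

variable {E : Type*} [NormedAddCommGroup E] [NormedSpace ℝ E]
  {N : Type*} [TopologicalSpace N] [ChartedSpace E N] [IsManifold 𝓘(ℝ, E) ∞ N]

/-- A field of bilinear forms on the tangent spaces. -/
abbrev BilinField (E : Type*) [NormedAddCommGroup E] [NormedSpace ℝ E]
    (N : Type*) [TopologicalSpace N] [ChartedSpace E N] : Type _ :=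
  ∀ x : N, TangentSpace 𝓘(ℝ, E) x →L[ℝ] TangentSpace 𝓘(ℝ, E) x →L[ℝ] ℝ

/-- A field of endomorphisms of the tangent spaces. -/
abbrev EndField (E : Type*) [NormedAddCommGroup E] [NormedSpace ℝ E]
    (N : Type*) [TopologicalSpace N] [ChartedSpace E N] : Type _ :=
  ∀ x : N, TangentSpace 𝓘(ℝ, E) x →L[ℝ] TangentSpace 𝓘(ℝ, E) x

/-- The value at `z` of the coordinate frame of the chart at `x`, as a map from the model space. -/
def coordFrame (x z : N) : E →L[ℝ] TangentSpace 𝓘(ℝ, E) z :=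
  (trivializationAt E (TangentSpace 𝓘(ℝ, E) : N → Type _) x).symmL ℝ z

/-- The components of tangent vectors at `z` in the chart at `x`. -/
def coordComponents (x z : N) : TangentSpace 𝓘(ℝ, E) z →L[ℝ] E :=
  (trivializationAt E (TangentSpace 𝓘(ℝ, E) : N → Type _) x).continuousLinearMapAt ℝ z

/-- The components `gᵢⱼ(y)` of `g` in the chart at `x`, as a function on the model space. -/
def chartMetric (g : BilinField E N) (x : N) (y : E) : E →L[ℝ] E →L[ℝ] ℝ :=
  let z := (extChartAt 𝓘(ℝ, E) x).symm y
  let S : E →L[ℝ] E := coordFrame x z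
  let G : E →L[ℝ] E →L[ℝ] ℝ := g z
  G.bilinearComp S S

/-- The components of an endomorphism field in the chart at `x`. -/
def chartEnd (J : EndField E N) (x : N) (y : E) : E →L[ℝ] E :=
  let z := (extChartAt 𝓘(ℝ, E) x).symm y
  coordComponents x z ∘L J z ∘L coordFrame x z

set_option synthInstance.maxHeartbeats 200000 in
/-- The Christoffel symbols `Γ(a, b)` of the Levi-Civita connection of `g`, in the chart at `x` and
at the point `x`:
`2 g (Γ(a, b), c) = ∂ₐ g (b, c) + ∂_b g (a, c) - ∂_c g (a, b)`. -/
def christoffel (g : BilinField E N) (x : N) (a b : TangentSpace 𝓘(ℝ, E) x) :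
    TangentSpace 𝓘(ℝ, E) x :=
  let D : E →L[ℝ] E →L[ℝ] E →L[ℝ] ℝ := fderiv ℝ (chartMetric g x) (extChartAt 𝓘(ℝ, E) x x)
  let κ : E →L[ℝ] ℝ := (1 / 2 : ℝ) • (D a b + D b a - (D.flip a).flip b)
  riesz (g x).toBilinForm (κ : E →ₗ[ℝ] ℝ)

/-- The covariant derivative `(∇_a J) b` at `x` for the Levi-Civita connection of `g`. -/
def nablaEnd (g : BilinField E N) (J : EndField E N) (x : N) (a b : TangentSpace 𝓘(ℝ, E) x) :
    TangentSpace 𝓘(ℝ, E) x :=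
  let D : E →L[ℝ] E →L[ℝ] E := fderiv ℝ (chartEnd J x) (extChartAt 𝓘(ℝ, E) x x)
  let Dab : TangentSpace 𝓘(ℝ, E) x := D a b
  Dab + christoffel g x a (J x b) - J x (christoffel g x a b)

variable (E N) in
/-- A Riemannian metric `g` and a compatible almost complex structure `J`, both smooth. -/
structure HermitianStructure where
  /-- the metric -/
  g : Bundle.ContMDiffRiemannianMetric 𝓘(ℝ, E) ∞ E (TangentSpace 𝓘(ℝ, E) : N → Type _)
  /-- the almost complex structure -/
  J : EndField E N
  contMDiff_J : ContMDiff 𝓘(ℝ, E) (𝓘(ℝ, E).prod 𝓘(ℝ, E →L[ℝ] E)) ∞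
    (fun x => Bundle.TotalSpace.mk' (E →L[ℝ] E)
      (E := fun x : N => TangentSpace 𝓘(ℝ, E) x →L[ℝ] TangentSpace 𝓘(ℝ, E) x) x (J x))
  J_sq : ∀ x v, J x (J x v) = -v
  compatible : ∀ x u v, g.inner x (J x u) (J x v) = g.inner x u v

/-- `(g, J)` is locally conformal Kähler with Lee form `lee`: every point has an open neighbourhood
`U` with a smooth function `f` such that `e^{-f} g` is a Kähler metric on `U` (that is, `J` is
parallel for its Levi-Civita connection) and `lee = df` on `U`. Since the Levi-Civita connection has
no torsion, parallelism of `J` contains the integrability of `J`. -/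
def IsLCK (A : HermitianStructure E N) (lee : ∀ x : N, TangentSpace 𝓘(ℝ, E) x →L[ℝ] ℝ) : Prop :=
  ∀ x : N, ∃ U : Set N, IsOpen U ∧ x ∈ U ∧ ∃ f : N → ℝ, ContMDiffOn 𝓘(ℝ, E) 𝓘(ℝ, ℝ) ∞ f U ∧
    (∀ z ∈ U, ∀ a b : TangentSpace 𝓘(ℝ, E) z,
      nablaEnd (fun y => Real.exp (-f y) • A.g.inner y) A.J z a b = 0) ∧
    ∀ z ∈ U, lee z = mfderiv 𝓘(ℝ, E) 𝓘(ℝ, ℝ) f z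

/-- The metric at a point as a bilinear form. -/
def HermitianStructure.form (A : HermitianStructure E N) (x : N) :
    LinearMap.BilinForm ℝ (TangentSpace 𝓘(ℝ, E) x) := (A.g.inner x).toBilinForm

/-- The Lee vector field: `g (B, v) = lee v`. -/
def leeField (A : HermitianStructure E N) (lee : ∀ x : N, TangentSpace 𝓘(ℝ, E) x →L[ℝ] ℝ) (x : N) :
    TangentSpace 𝓘(ℝ, E) x := riesz (A.form x) (lee x : TangentSpace 𝓘(ℝ, E) x →ₗ[ℝ] ℝ)

end Ambient

/-! ### Submanifolds

The submanifold `M`, immersed by `φ`, has no boundary: the model `I` has range `univ`. -/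

section Submanifold

variable {E : Type*} [NormedAddCommGroup E] [NormedSpace ℝ E]
  {N : Type*} [TopologicalSpace N] [ChartedSpace E N] [IsManifold 𝓘(ℝ, E) ∞ N]
  {E' H : Type*} [NormedAddCommGroup E'] [NormedSpace ℝ E'] [TopologicalSpace H]
  {I : ModelWithCorners ℝ E' H}
  {M : Type*} [TopologicalSpace M] [ChartedSpace H M]

variable (I) (A : HermitianStructure E N) (φ : M → N) (p : M)

/-- The metric that the immersion `φ` induces on the tangent space at `p`. -/
def inducedForm : LinearMap.BilinForm ℝ (TangentSpace I p) :=
  (A.form (φ p)).compl₁₂ (mfderiv I 𝓘(ℝ, E) φ p).toLinearMap (mfderiv I 𝓘(ℝ, E) φ p).toLinearMap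

/-- The tangential part of `ξ`, as a tangent vector of `M`. -/
def tangentPart (ξ : TangentSpace 𝓘(ℝ, E) (φ p)) : TangentSpace I p :=
  riesz (inducedForm I A φ p) (A.form (φ p) ξ ∘ₗ (mfderiv I 𝓘(ℝ, E) φ p).toLinearMap)

/-- The normal part of `ξ`. -/
def normalPart (ξ : TangentSpace 𝓘(ℝ, E) (φ p)) : TangentSpace 𝓘(ℝ, E) (φ p) :=
  ξ - mfderiv I 𝓘(ℝ, E) φ p (tangentPart I A φ p ξ)

/-- `P u`, the tangential part of `J u`. -/
def P (u : TangentSpace I p) : TangentSpace I p :=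
  tangentPart I A φ p (A.J (φ p) (mfderiv I 𝓘(ℝ, E) φ p u))

/-- `F u`, the normal part of `J u`. -/
def F (u : TangentSpace I p) : TangentSpace 𝓘(ℝ, E) (φ p) :=
  normalPart I A φ p (A.J (φ p) (mfderiv I 𝓘(ℝ, E) φ p u))

/-- The subspace `F D` of the normal space, for a subspace `D` of the tangent space. -/
def FImage (D : Submodule ℝ (TangentSpace I p)) : Submodule ℝ (TangentSpace 𝓘(ℝ, E) (φ p)) :=
  Submodule.span ℝ (F I A φ p '' D)

/-- The ambient covariant derivative at `p`, in direction `u`, of `dφ(V)`, where `V` has the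
constant value `v` in the chart at `p`: `∂ᵤ∂ᵥφ + Γ(dφ u, dφ v)` in the charts at `p` and `φ p`. -/
def covDeriv (u v : TangentSpace I p) : TangentSpace 𝓘(ℝ, E) (φ p) :=
  let D : E' →L[ℝ] E' →L[ℝ] E :=
    fderiv ℝ (fderiv ℝ (writtenInExtChartAt I 𝓘(ℝ, E) p φ)) (extChartAt I p p)
  let Duv : TangentSpace 𝓘(ℝ, E) (φ p) := D u v
  Duv + christoffel (fun x => A.g.inner x) (φ p) (mfderiv I 𝓘(ℝ, E) φ p u) (mfderiv I 𝓘(ℝ, E) φ p v)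

/-- The second fundamental form `h`: the normal part of the ambient covariant derivative. -/
def sff (u v : TangentSpace I p) : TangentSpace 𝓘(ℝ, E) (φ p) :=
  normalPart I A φ p (covDeriv I A φ p u v)

/-- The component `H_D` of the mean curvature vector: the trace of `h` over `D`. -/
def meanCurvatureOn (D : Submodule ℝ (TangentSpace I p)) : TangentSpace 𝓘(ℝ, E) (φ p) :=
  traceOn (inducedForm I A φ p) D (sff I A φ p)

/-- The squared norm `‖h‖²` of the second fundamental form. -/
def sffNormSq : ℝ := normSq (inducedForm I A φ p) (A.form (φ p)) (sff I A φ p)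

/-- `M` is minimal: the mean curvature vector `H`, the trace of `h`, vanishes. -/
def IsMinimal : Prop := ∀ p : M, meanCurvatureOn I A φ p ⊤ = 0

end Submanifold

/-! ### Warped products -/

section Warped

variable {E : Type*} [NormedAddCommGroup E] [NormedSpace ℝ E]
  {N : Type*} [TopologicalSpace N] [ChartedSpace E N] [IsManifold 𝓘(ℝ, E) ∞ N]
  {E₁ : Type*} [NormedAddCommGroup E₁] [NormedSpace ℝ E₁]
  {M₁ : Type*} [TopologicalSpace M₁] [ChartedSpace E₁ M₁] [IsManifold 𝓘(ℝ, E₁) ∞ M₁]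
  {E₂ : Type*} [NormedAddCommGroup E₂] [NormedSpace ℝ E₂]
  {M₂ : Type*} [TopologicalSpace M₂] [ChartedSpace E₂ M₂] [IsManifold 𝓘(ℝ, E₂) ∞ M₂]

variable (E₁ M₁ E₂ M₂) in
/-- The tangent spaces of the first factor, `D^{θ₁}(p, q) = T(M₁ × {q})`. -/
def D₁ (p : M₁ × M₂) : Submodule ℝ (TangentSpace (𝓘(ℝ, E₁).prod 𝓘(ℝ, E₂)) p) :=
  (mfderiv (𝓘(ℝ, E₁).prod 𝓘(ℝ, E₂)) 𝓘(ℝ, E₂) (Prod.snd : M₁ × M₂ → M₂) p).toLinearMap.ker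

variable (E₁ M₁ E₂ M₂) in
/-- The tangent spaces of the second factor, `D^{θ₂}(p, q) = T({p} × M₂)`. -/
def D₂ (p : M₁ × M₂) : Submodule ℝ (TangentSpace (𝓘(ℝ, E₁).prod 𝓘(ℝ, E₂)) p) :=
  (mfderiv (𝓘(ℝ, E₁).prod 𝓘(ℝ, E₂)) 𝓘(ℝ, E₁) (Prod.fst : M₁ × M₂ → M₁) p).toLinearMap.ker

/-- The warped product metric `π₁^* g₁ + lam² π₂^* g₂`. -/
def warpedMetric
    (g₁ : Bundle.ContMDiffRiemannianMetric 𝓘(ℝ, E₁) ∞ E₁ (TangentSpace 𝓘(ℝ, E₁) : M₁ → Type _))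
    (g₂ : Bundle.ContMDiffRiemannianMetric 𝓘(ℝ, E₂) ∞ E₂ (TangentSpace 𝓘(ℝ, E₂) : M₂ → Type _))
    (lam : M₁ → ℝ) (p : M₁ × M₂) (u v : TangentSpace (𝓘(ℝ, E₁).prod 𝓘(ℝ, E₂)) p) : ℝ :=
  let dπ₁ := mfderiv (𝓘(ℝ, E₁).prod 𝓘(ℝ, E₂)) 𝓘(ℝ, E₁) (Prod.fst : M₁ × M₂ → M₁) p
  let dπ₂ := mfderiv (𝓘(ℝ, E₁).prod 𝓘(ℝ, E₂)) 𝓘(ℝ, E₂) (Prod.snd : M₁ × M₂ → M₂) p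
  g₁.inner p.1 (dπ₁ u) (dπ₁ v) + lam p.1 ^ 2 * g₂.inner p.2 (dπ₂ u) (dπ₂ v)

/-- The smooth map `φ` immerses the warped product `M₁ ×_lam M₂` isometrically into `(N, g)`. -/
structure IsWarpedProductImmersion (A : HermitianStructure E N)
    (g₁ : Bundle.ContMDiffRiemannianMetric 𝓘(ℝ, E₁) ∞ E₁ (TangentSpace 𝓘(ℝ, E₁) : M₁ → Type _))
    (g₂ : Bundle.ContMDiffRiemannianMetric 𝓘(ℝ, E₂) ∞ E₂ (TangentSpace 𝓘(ℝ, E₂) : M₂ → Type _))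
    (lam : M₁ → ℝ) (φ : M₁ × M₂ → N) : Prop where
  lam_pos : ∀ x, 0 < lam x
  contMDiff_lam : ContMDiff 𝓘(ℝ, E₁) 𝓘(ℝ, ℝ) ∞ lam
  contMDiff_φ : ContMDiff (𝓘(ℝ, E₁).prod 𝓘(ℝ, E₂)) 𝓘(ℝ, E) ∞ φ
  isometric : ∀ p u v,
    inducedForm (𝓘(ℝ, E₁).prod 𝓘(ℝ, E₂)) A φ p u v = warpedMetric g₁ g₂ lam p u v

/-- The factors are pointwise slant, with slant functions `θ₁` on `M₁` and `θ₂` on `M₂` that take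
values in `(0, π/2)` and differ at every point. -/
structure IsPointwiseBiSlant (A : HermitianStructure E N) (φ : M₁ × M₂ → N)
    (θ₁ : M₁ → ℝ) (θ₂ : M₂ → ℝ) : Prop where
  θ₁_mem : ∀ x, θ₁ x ∈ Ioo 0 (Real.pi / 2)
  θ₂_mem : ∀ y, θ₂ y ∈ Ioo 0 (Real.pi / 2)
  ne : ∀ x y, θ₁ x ≠ θ₂ y
  slant₁ : ∀ p, ∀ u ∈ D₁ E₁ M₁ E₂ M₂ p,
    P (𝓘(ℝ, E₁).prod 𝓘(ℝ, E₂)) A φ p (P (𝓘(ℝ, E₁).prod 𝓘(ℝ, E₂)) A φ p u)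
      = -(Real.cos (θ₁ p.1) ^ 2) • u
  slant₂ : ∀ p, ∀ u ∈ D₂ E₁ M₁ E₂ M₂ p,
    P (𝓘(ℝ, E₁).prod 𝓘(ℝ, E₂)) A φ p (P (𝓘(ℝ, E₁).prod 𝓘(ℝ, E₂)) A φ p u)
      = -(Real.cos (θ₂ p.2) ^ 2) • u

variable (E₁ E₂) in
/-- The subspace `F D^{θ₁}` of the normal space at `p`. -/
def FD₁ (A : HermitianStructure E N) (φ : M₁ × M₂ → N) (p : M₁ × M₂) :
    Submodule ℝ (TangentSpace 𝓘(ℝ, E) (φ p)) :=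
  FImage (𝓘(ℝ, E₁).prod 𝓘(ℝ, E₂)) A φ p (D₁ E₁ M₁ E₂ M₂ p)

variable (E₁ E₂) in
/-- The subspace `F D^{θ₂}` of the normal space at `p`. -/
def FD₂ (A : HermitianStructure E N) (φ : M₁ × M₂ → N) (p : M₁ × M₂) :
    Submodule ℝ (TangentSpace 𝓘(ℝ, E) (φ p)) :=
  FImage (𝓘(ℝ, E₁).prod 𝓘(ℝ, E₂)) A φ p (D₂ E₁ M₁ E₂ M₂ p)

variable (E₁ E₂) in
/-- `M₁ × M₂` is mixed totally geodesic: `h (D^{θ₁}, D^{θ₂}) = 0`. -/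
def IsMixedTotallyGeodesic (A : HermitianStructure E N) (φ : M₁ × M₂ → N) : Prop :=
  ∀ p : M₁ × M₂, ∀ u ∈ D₁ E₁ M₁ E₂ M₂ p, ∀ v ∈ D₂ E₁ M₁ E₂ M₂ p,
    sff (𝓘(ℝ, E₁).prod 𝓘(ℝ, E₂)) A φ p u v = 0

variable (E₁ E₂) in
/-- The right-hand side of the inequality at the point `p`. -/
def lowerBound (A : HermitianStructure E N) (lee : ∀ x : N, TangentSpace 𝓘(ℝ, E) x →L[ℝ] ℝ)
    (φ : M₁ × M₂ → N) (θ₁ : M₁ → ℝ) (θ₂ : M₂ → ℝ) (n₁ n₂ : ℕ) (p : M₁ × M₂) : ℝ :=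
  let g := A.form (φ p)
  let s₁ := Real.sin (θ₁ p.1)
  let s₂ := Real.sin (θ₂ p.2)
  let B₁ := proj g (FD₁ E₁ E₂ A φ p) (leeField A lee (φ p))
  let B₂ := proj g (FD₂ E₁ E₂ A φ p) (leeField A lee (φ p))
  let H₁ := meanCurvatureOn (𝓘(ℝ, E₁).prod 𝓘(ℝ, E₂)) A φ p (D₁ E₁ M₁ E₂ M₂ p)
  let H₂ := meanCurvatureOn (𝓘(ℝ, E₁).prod 𝓘(ℝ, E₂)) A φ p (D₂ E₁ M₁ E₂ M₂ p)
  (n₁ : ℝ) / 2 * s₂ ^ 2 * g B₂ B₂ + (n₂ : ℝ) / 2 * s₁ ^ 2 * g B₁ B₁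
    + s₂ * g (proj g (FD₂ E₁ E₂ A φ p) H₁) B₂ + s₁ * g (proj g (FD₁ E₁ E₂ A φ p) H₂) B₁

end Warped

end LCK

end

/-! Write `β` for the induced metric, `γ` for the ambient one and `η` for the Lee form. The heart of
the matter is a Codazzi-type identity: for `x`, `y` in one factor and `z` in the other, `γ(h(x,y),
Fz) + ½ β(x,y) γ(B, Fz) = γ(h(x,z), Fy)`.

Since `P` preserves both factors, the two-form `Ω(u,v) = γ(Ju,v)` vanishes on mixed pairs.
Differentiating `Ω(y,z) = 0` along `x`, with the formula for `∇J` on a locally conformal Kähler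
manifold, gives the identity up to multiples of `½η(z) - κ(z)` and `½η(Pz) - κ(Pz)`. Here `2κ` is
the logarithmic derivative, along the factor of `z`, of the metric on the factor of `x`: it is `0`
along the second factor and `2 d log λ` along the first. The error terms vanish because the slant
angle of the factor of `x` is constant along the factor of `z`: differentiating `|Px|² = cos²θ |x|²`
along `z` yields `η(z) = 2κ(z)`. This is `codazzi_of_derivatives`, fed by `codazzi` and specialised
in `codazzi_D₁` and `codazzi_D₂`.

The rest is linear algebra (`estimate`). For orthonormal frames `e` of `D₁` and `f` of `D₂`, the
vectors `F eⱼ / s₁` and `F fₖ / s₂`, with `sᵢ = sin θᵢ`, are orthonormal in the normal space. The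
components `a` of `h(eᵢ,eⱼ)` on `F fₖ / s₂` and `d` of `h(eᵢ,fₖ)` on `F eⱼ / s₁` satisfy `s₁ d = s₂
(a + b)`, with `b` the diagonal Lee term. Half of the right-hand side is the sum of `s₂² b² + 2 s₂ a
b`, and `a² + 2d²` exceeds this by at least `(2 - (1-s₂)² - s₁²)(a² + d²)`. Exchanging the factors
gives the other half.

That coefficient is positive, so equality forces all these components to vanish; the lower bound is
then nonpositive, and `h = 0` at the point. Both equality statements follow at once. -/

namespace LCK

/-! ### Orthonormal frames, traces and projections -/

section Frames

variable {V : Type*} [AddCommGroup V] [Module ℝ V] {V' : Type*} [AddCommGroup V'] [Module ℝ V']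

/-- An orthonormal family in `W` in which every vector of `W` can be expanded. -/
structure IsFrame (β : LinearMap.BilinForm ℝ V) (W : Submodule ℝ V) {ι : Type*} [Fintype ι]
    [DecidableEq ι] (e : ι → V) : Prop where
  mem : ∀ i, e i ∈ W
  orth : ∀ i j, β (e i) (e j) = if i = j then 1 else 0
  expand : ∀ x ∈ W, x = ∑ i, β x (e i) • e i

theorem IsInnerProduct.nonneg {β : LinearMap.BilinForm ℝ V} (hβ : IsInnerProduct β) (v : V) :
    0 ≤ β v v := by
  by_cases h : v = 0
  · simp [h]
  · exact (hβ.2 v h).le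

theorem IsInnerProduct.eq_zero {β : LinearMap.BilinForm ℝ V} (hβ : IsInnerProduct β) {v : V}
    (h : β v v = 0) : v = 0 := by
  by_contra hv
  exact (hβ.2 v hv).ne' h

theorem IsInnerProduct.ext {β : LinearMap.BilinForm ℝ V} (hβ : IsInnerProduct β) {v w : V}
    (h : ∀ x, β v x = β w x) : v = w := by
  rw [← sub_eq_zero]
  apply hβ.eq_zero
  simp [h]

variable {β : LinearMap.BilinForm ℝ V}

/-- Orthonormality gives linear independence, and the number of vectors is the dimension of `W`, so
they span. -/
theorem IsOrthonormalBasis.isFrame [FiniteDimensional ℝ V] {W : Submodule ℝ V}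
    {e : Fin (finrank ℝ W) → V}
    (h : IsOrthonormalBasis β W e) : IsFrame β W e := by
  refine ⟨h.1, h.2, ?_⟩
  let e' : Fin (finrank ℝ W) → W := fun i => ⟨e i, h.1 i⟩
  have hli : LinearIndependent ℝ e' := by
    rw [Fintype.linearIndependent_iff]
    intro c hc i
    have h1 : ∑ j, c j • e j = 0 := by
      simpa [e'] using congrArg (Subtype.val) hc
    have h2 := congrArg (fun x => β x (e i)) h1
    simpa [h.2] using h2
  have hspan := hli.span_eq_top_of_card_eq_finrank' (by simp)
  intro x hx
  have hx' : (⟨x, hx⟩ : W) ∈ Submodule.span ℝ (Set.range e') := by rw [hspan]; trivial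
  obtain ⟨c, hc⟩ := (Submodule.mem_span_range_iff_exists_fun ℝ).1 hx'
  have h1 : ∑ j, c j • e j = x := by simpa [e'] using congrArg (Subtype.val) hc
  have h2 : ∀ i, β x (e i) = c i := fun i => by rw [← h1]; simp [h.2]
  simp only [h2, h1]

theorem frame_isFrame [FiniteDimensional ℝ V] (hβ : IsInnerProduct β) (W : Submodule ℝ V) :
    IsFrame β W (frame β W) :=
  (frame_spec hβ W).isFrame

variable {ι : Type*} [Fintype ι] [DecidableEq ι] {ι' : Type*} [Fintype ι'] [DecidableEq ι']
  {W : Submodule ℝ V} {e : ι → V} {f : ι' → V}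

theorem IsFrame.parseval (he : IsFrame β W e) (hβ : IsInnerProduct β) {x : V} (hx : x ∈ W) (y : V) :
    β x y = ∑ i, β x (e i) * β y (e i) := by
  conv_lhs => rw [he.expand x hx]
  simp [hβ.1 _ y]

/-- The matrix `β(eᵢ, fⱼ)` relating two frames of the same subspace is orthogonal, by Parseval.
Hence traces do not depend on the frame chosen by `frame`. -/
theorem IsFrame.sum_apply_eq (he : IsFrame β W e) (hf : IsFrame β W f) (hβ : IsInnerProduct β)
    (b : V →ₗ[ℝ] V →ₗ[ℝ] ℝ) : ∑ i, b (e i) (e i) = ∑ j, b (f j) (f j) := by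
  have h1 : ∀ i, b (e i) (e i) = ∑ j, ∑ k, (β (e i) (f j) * β (e i) (f k)) * b (f j) (f k) := by
    intro i
    conv_lhs => rw [hf.expand (e i) (he.mem i)]
    simp [Finset.mul_sum, mul_assoc]
    rw [Finset.sum_comm]
    refine Finset.sum_congr rfl fun j _ => Finset.sum_congr rfl fun k _ => by ring
  simp only [h1]
  rw [Finset.sum_comm]
  refine Finset.sum_congr rfl fun j _ => ?_
  rw [Finset.sum_comm]
  simp only [← Finset.sum_mul]
  have h2 : ∀ k, ∑ i, β (e i) (f j) * β (e i) (f k) = if j = k then 1 else 0 := by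
    intro k
    rw [← hf.orth j k, he.parseval hβ (hf.mem j)]
    simp [hβ.1 (f _)]
  simp [h2]

theorem IsFrame.sum_sq_le (he : IsFrame β W e) (hβ : IsInnerProduct β) (v : V) :
    ∑ i, β v (e i) ^ 2 ≤ β v v := by
  have h := hβ.nonneg (v - ∑ i, β v (e i) • e i)
  simp only [map_sub, LinearMap.sub_apply, map_sum, map_smul, LinearMap.sum_apply,
    LinearMap.smul_apply, smul_eq_mul, he.orth, hβ.1 (e _) v] at h
  simp only [mul_ite, mul_one, mul_zero, Finset.sum_ite_eq', Finset.mem_univ, if_true,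
    ← pow_two, sub_self, Finset.sum_const_zero] at h
  linarith

theorem IsFrame.proj_proj [FiniteDimensional ℝ V] (he : IsFrame β W e) (hβ : IsInnerProduct β)
    (v w : V) : β (proj β W v) (proj β W w) = ∑ i, β v (e i) * β w (e i) := by
  rw [he.parseval hβ (proj_mem β W v)]
  simp [proj_apply hβ W _ (he.mem _)]

theorem IsFrame.sumElim {W₁ W₂ : Submodule ℝ V} {e : ι → V} {f : ι' → V} (he : IsFrame β W₁ e)
    (hf : IsFrame β W₂ f) (hβ : IsInnerProduct β) (horth : ∀ x ∈ W₁, ∀ y ∈ W₂, β x y = 0) :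
    IsFrame β (W₁ ⊔ W₂) (Sum.elim e f) := by
  refine ⟨?_, ?_, ?_⟩
  · rintro (i | j)
    · exact Submodule.mem_sup_left (he.mem i)
    · exact Submodule.mem_sup_right (hf.mem j)
  · rintro (i | i) (j | j)
    · simp [he.orth]
    · simp [horth _ (he.mem i) _ (hf.mem j)]
    · simp [hβ.1 (f i), horth _ (he.mem j) _ (hf.mem i)]
    · simp [hf.orth]
  · intro x hx
    obtain ⟨y, hy, z, hz, rfl⟩ := Submodule.mem_sup.1 hx
    have h1 : ∀ i, β z (e i) = 0 := fun i => by rw [hβ.1, horth _ (he.mem i) _ hz]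
    have h2 : ∀ i, β y (f i) = 0 := fun i => horth _ hy _ (hf.mem i)
    simp [h1, h2, ← he.expand y hy, ← hf.expand z hz]

/-- The frame is changed in one slot at a time, the other being held fixed. This allows a frame
adapted to the splitting of the tangent space. -/
theorem normSq_eq_sum [FiniteDimensional ℝ V] {β' : LinearMap.BilinForm ℝ V'}
    (hβ : IsInnerProduct β) (h : V →ₗ[ℝ] V →ₗ[ℝ] V') (he : IsFrame β ⊤ e) :
    normSq β β' (fun u v => h u v) = ∑ i, ∑ j, β' (h (e i) (e j)) (h (e i) (e j)) := by
  have hf := frame_isFrame hβ (⊤ : Submodule ℝ V)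
  have h1 : ∀ x, ∑ j, β' (h x (frame β ⊤ j)) (h x (frame β ⊤ j)) =
      ∑ j, β' (h x (e j)) (h x (e j)) := fun x =>
    hf.sum_apply_eq he hβ (β'.compl₁₂ (h x) (h x))
  unfold normSq
  simp only [h1]
  rw [Finset.sum_comm, Finset.sum_comm (f := fun i j => β' (h (e i) (e j)) (h (e i) (e j)))]
  refine Finset.sum_congr rfl fun j _ => ?_
  exact hf.sum_apply_eq he hβ (β'.compl₁₂ (h.flip (e j)) (h.flip (e j)))

/-- The image of an orthonormal frame under a homothety. -/
theorem IsFrame.map {D : Submodule ℝ V} {e : ι → V} (he : IsFrame β D e)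
    {γ : LinearMap.BilinForm ℝ V'} (F : V →ₗ[ℝ] V') {s : ℝ} (hs : 0 < s)
    (hF : ∀ x ∈ D, ∀ y ∈ D, γ (F x) (F y) = s ^ 2 * β x y) :
    IsFrame γ (Submodule.span ℝ (F '' D)) (fun i => s⁻¹ • F (e i)) := by
  refine ⟨fun i => Submodule.smul_mem _ _ (Submodule.subset_span ⟨_, he.mem i, rfl⟩), ?_, ?_⟩
  · intro i j
    simp only [map_smul, LinearMap.smul_apply, smul_eq_mul, hF _ (he.mem i) _ (he.mem j), he.orth]
    split_ifs <;> field_simp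
  · rw [Submodule.span_image, Submodule.span_eq]
    rintro _ ⟨x, hx, rfl⟩
    conv_lhs => rw [he.expand x hx]
    simp only [map_sum, map_smul, smul_smul]
    refine Finset.sum_congr rfl fun i _ => ?_
    rw [hF _ hx _ (he.mem i)]
    congr 1
    simp only [smul_eq_mul]
    field_simp

end Frames

/-! ### The algebraic estimate in components -/

section Inequality

variable {ι κ : Type*} [Fintype ι] [Fintype κ]

/-- The pointwise estimate of one half of the components. -/
theorem sq_add_le_of_mul_eq {a b d s₁ s₂ : ℝ} (h : s₁ * d = s₂ * (a + b)) :
    (2 - (1 - s₂) ^ 2 - s₁ ^ 2) * (a ^ 2 + d ^ 2) ≤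
      a ^ 2 + 2 * d ^ 2 - s₂ ^ 2 * b ^ 2 - 2 * s₂ * (a * b) := by
  -- The right-hand side of the claim is `2(a² + d²) - (a + s₂ b)²`. The constraint writes `a + s₂
  -- b` as the inner product of `(1 - s₂, s₁)` with `(a, d)`, and Cauchy–Schwarz applies; its defect
  -- is the square passed to `nlinarith`.
  have h1 : a + s₂ * b = (1 - s₂) * a + s₁ * d := by rw [h]; ring
  have h2 : (a + s₂ * b) ^ 2 ≤ ((1 - s₂) ^ 2 + s₁ ^ 2) * (a ^ 2 + d ^ 2) := by
    rw [h1]; nlinarith [sq_nonneg ((1 - s₂) * d - s₁ * a)]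
  nlinarith

variable {V : Type*} [AddCommGroup V] [Module ℝ V] {T : Type*} [AddCommGroup T] [Module ℝ T]
  [DecidableEq ι] [DecidableEq κ]

theorem sum_diagonal {ι κ : Type*} [Fintype ι] [Fintype κ] [DecidableEq ι] (g : ι → ι → κ → ℝ) :
    ∑ i, ∑ j, ∑ k, (if i = j then g i j k else 0) = ∑ i, ∑ k, g i i k := by
  refine Finset.sum_congr rfl fun i _ => ?_
  rw [Finset.sum_comm]
  simp

/-- One half of the estimate: the components of `h` on `D₁ × D₁` with values in `F D₂`, and those
on `D₁ × D₂` with values in `F D₁`. -/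
theorem half_estimate {β : LinearMap.BilinForm ℝ V} {γ : LinearMap.BilinForm ℝ T}
    {D₁ D₂ : Submodule ℝ V} {e : ι → V} {f : κ → V} (he : IsFrame β D₁ e) (hf : IsFrame β D₂ f)
    (F : V →ₗ[ℝ] T) (h : V →ₗ[ℝ] V →ₗ[ℝ] T) (B : T) {s₁ s₂ : ℝ} (hs₁ : 0 < s₁) (hs₂ : 0 < s₂)
    (hC : ∀ x ∈ D₁, ∀ y ∈ D₁, ∀ z ∈ D₂,
      γ (h x y) (F z) + 1 / 2 * β x y * γ B (F z) = γ (h x z) (F y)) :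
    (2 - (1 - s₂) ^ 2 - s₁ ^ 2) * ((∑ i, ∑ j, ∑ k, γ (h (e i) (e j)) (s₂⁻¹ • F (f k)) ^ 2)
        + ∑ i, ∑ j, ∑ k, γ (h (e i) (f k)) (s₁⁻¹ • F (e j)) ^ 2)
      + ((Fintype.card ι : ℝ) / 4 * s₂ ^ 2 * (∑ k, γ B (s₂⁻¹ • F (f k)) * γ B (s₂⁻¹ • F (f k)))
      + s₂ * ∑ k, γ (∑ i, h (e i) (e i)) (s₂⁻¹ • F (f k)) * γ B (s₂⁻¹ • F (f k))) ≤
    (∑ i, ∑ j, ∑ k, γ (h (e i) (e j)) (s₂⁻¹ • F (f k)) ^ 2)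
        + 2 * ∑ i, ∑ j, ∑ k, γ (h (e i) (f k)) (s₁⁻¹ • F (e j)) ^ 2 := by
  set a : ι → ι → κ → ℝ := fun i j k => γ (h (e i) (e j)) (s₂⁻¹ • F (f k)) with ha
  set d : ι → ι → κ → ℝ := fun i j k => γ (h (e i) (f k)) (s₁⁻¹ • F (e j)) with hd
  set c : κ → ℝ := fun k => γ B (s₂⁻¹ • F (f k)) with hc
  -- The Lee term of the Codazzi identity, present only for `i = j` because `β(eᵢ, eⱼ) = δᵢⱼ`. It
  -- produces both the `‖B‖²` term and, paired with `a`, the trace of `h`.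
  set b : ι → ι → κ → ℝ := fun i j k => 1 / 2 * (if i = j then 1 else 0) * c k with hb
  have key : ∀ i j k, s₁ * d i j k = s₂ * (a i j k + b i j k) := by
    intro i j k
    have := hC _ (he.mem i) _ (he.mem j) _ (hf.mem k)
    simp only [ha, hd, hb, hc, map_smul, smul_eq_mul, ← this, he.orth]
    field_simp
  have hsum := Finset.sum_le_sum fun i (_ : i ∈ (Finset.univ : Finset ι)) =>
    Finset.sum_le_sum fun j (_ : j ∈ (Finset.univ : Finset ι)) =>
    Finset.sum_le_sum fun k (_ : k ∈ (Finset.univ : Finset κ)) => sq_add_le_of_mul_eq (key i j k)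
  -- The diagonal contributes `(½)²` for each index `i`; with `2n₁` indices this is the constant
  -- `n₁/2` of the theorem.
  have h1 : ∑ i, ∑ j, ∑ k, b i j k ^ 2 = (Fintype.card ι : ℝ) / 4 * ∑ k, c k * c k := by
    have : ∀ i j k, b i j k ^ 2 = if i = j then 1 / 4 * (c k * c k) else 0 := by
      intro i j k; simp only [hb]; split_ifs <;> ring
    simp only [this, sum_diagonal (fun _ _ k => 1 / 4 * (c k * c k)), Finset.sum_const,
      ← Finset.mul_sum, Finset.card_univ, nsmul_eq_mul]
    ring
  have h2 : ∑ i, ∑ j, ∑ k, a i j k * b i j k =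
      1 / 2 * ∑ k, γ (∑ i, h (e i) (e i)) (s₂⁻¹ • F (f k)) * c k := by
    have : ∀ i j k, a i j k * b i j k = if i = j then 1 / 2 * (a i j k * c k) else 0 := by
      intro i j k; simp only [hb]; split_ifs <;> ring
    simp only [this]
    rw [sum_diagonal (fun i j k => 1 / 2 * (a i j k * c k)), Finset.sum_comm, Finset.mul_sum]
    refine Finset.sum_congr rfl fun k _ => ?_
    rw [← Finset.mul_sum, ← Finset.sum_mul]
    simp only [ha, map_sum, LinearMap.sum_apply]
  simp only [Finset.sum_add_distrib, Finset.sum_sub_distrib, ← Finset.mul_sum, h1, h2] at hsum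
  linarith

/-- The coefficients are positive because both `sᵢ` lie in `(0, 1)`. In case of equality they force
`aᵢ = dᵢ = 0`; then each `rᵢ ≤ 0`, so the total, which is nonnegative and equals `r₁ + r₂`,
vanishes. -/
theorem combine_halves {s₁ s₂ X Y Z a₁ a₂ d₁ d₂ r₁ r₂ : ℝ} (hs₁ : 0 < s₁) (hs₂ : 0 < s₂)
    (hs₁' : s₁ < 1) (hs₂' : s₂ < 1) (ha₁ : 0 ≤ a₁) (ha₂ : 0 ≤ a₂) (hd₁ : 0 ≤ d₁) (hd₂ : 0 ≤ d₂)
    (hX : a₁ ≤ X) (hZ : a₂ ≤ Z) (hY : d₁ + d₂ ≤ Y)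
    (h₁ : (2 - (1 - s₂) ^ 2 - s₁ ^ 2) * (a₁ + d₁) + r₁ ≤ a₁ + 2 * d₁)
    (h₂ : (2 - (1 - s₁) ^ 2 - s₂ ^ 2) * (a₂ + d₂) + r₂ ≤ a₂ + 2 * d₂) :
    r₁ + r₂ ≤ X + 2 * Y + Z ∧ (X + 2 * Y + Z = r₁ + r₂ → X + 2 * Y + Z = 0) := by
  have ε₁ : 0 < 2 - (1 - s₂) ^ 2 - s₁ ^ 2 := by nlinarith
  have ε₂ : 0 < 2 - (1 - s₁) ^ 2 - s₂ ^ 2 := by nlinarith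
  have m₁ := mul_nonneg ε₁.le (add_nonneg ha₁ hd₁)
  have m₂ := mul_nonneg ε₂.le (add_nonneg ha₂ hd₂)
  refine ⟨by linarith, fun heq => ?_⟩
  have z₁ : a₁ + d₁ = 0 := (mul_eq_zero.1 (by linarith : _ * (a₁ + d₁) = 0)).resolve_left ε₁.ne'
  have z₂ : a₂ + d₂ = 0 := (mul_eq_zero.1 (by linarith : _ * (a₂ + d₂) = 0)).resolve_left ε₂.ne'
  rw [z₁] at h₁
  rw [z₂] at h₂
  linarith

/-- The inequality at a point, for abstract data that satisfy the two Codazzi-type identities. -/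
theorem estimate [FiniteDimensional ℝ V] [FiniteDimensional ℝ T]
    {β : LinearMap.BilinForm ℝ V} {γ : LinearMap.BilinForm ℝ T}
    (hβ : IsInnerProduct β) (hγ : IsInnerProduct γ) {D₁ D₂ : Submodule ℝ V}
    (hD : D₁ ⊔ D₂ = ⊤) (horth : ∀ x ∈ D₁, ∀ y ∈ D₂, β x y = 0)
    (F : V →ₗ[ℝ] T) (h : V →ₗ[ℝ] V →ₗ[ℝ] T) (hsymm : ∀ u v, h u v = h v u)
    (B : T) {s₁ s₂ : ℝ} (hs₁ : 0 < s₁) (hs₂ : 0 < s₂) (hs₁' : s₁ < 1) (hs₂' : s₂ < 1)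
    (hF₁ : ∀ x ∈ D₁, ∀ y ∈ D₁, γ (F x) (F y) = s₁ ^ 2 * β x y)
    (hF₂ : ∀ x ∈ D₂, ∀ y ∈ D₂, γ (F x) (F y) = s₂ ^ 2 * β x y)
    (hF₁₂ : ∀ x ∈ D₁, ∀ y ∈ D₂, γ (F x) (F y) = 0)
    (hC₁ : ∀ x ∈ D₁, ∀ y ∈ D₁, ∀ z ∈ D₂,
      γ (h x y) (F z) + 1 / 2 * β x y * γ B (F z) = γ (h x z) (F y))
    (hC₂ : ∀ x ∈ D₂, ∀ y ∈ D₂, ∀ z ∈ D₁,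
      γ (h x y) (F z) + 1 / 2 * β x y * γ B (F z) = γ (h x z) (F y))
    {n₁ n₂ : ℕ} (hn₁ : finrank ℝ D₁ = 2 * n₁) (hn₂ : finrank ℝ D₂ = 2 * n₂) :
    let B₁ := proj γ (Submodule.span ℝ (F '' D₁)) B
    let B₂ := proj γ (Submodule.span ℝ (F '' D₂)) B
    let H₁ := traceOn β D₁ (fun u v => h u v)
    let H₂ := traceOn β D₂ (fun u v => h u v)
    let R := (n₁ : ℝ) / 2 * s₂ ^ 2 * γ B₂ B₂ + (n₂ : ℝ) / 2 * s₁ ^ 2 * γ B₁ B₁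
      + s₂ * γ (proj γ (Submodule.span ℝ (F '' D₂)) H₁) B₂
      + s₁ * γ (proj γ (Submodule.span ℝ (F '' D₁)) H₂) B₁
    R ≤ normSq β γ (fun u v => h u v) ∧
      (normSq β γ (fun u v => h u v) = R → ∀ u v, h u v = 0) := by
  intro B₁ B₂ H₁ H₂ R
  set e := frame β D₁
  set f := frame β D₂
  have he : IsFrame β D₁ e := frame_isFrame hβ D₁
  have hf : IsFrame β D₂ f := frame_isFrame hβ D₂
  have hef : IsFrame β ⊤ (Sum.elim e f) := hD ▸ he.sumElim hf hβ horth
  have hFe := he.map F hs₁ hF₁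
  have hFf := hf.map F hs₂ hF₂
  have horth' : ∀ x ∈ Submodule.span ℝ (F '' D₁), ∀ y ∈ Submodule.span ℝ (F '' D₂), γ x y = 0 := by
    rw [Submodule.span_image, Submodule.span_eq, Submodule.span_image, Submodule.span_eq]
    rintro _ ⟨x, hx, rfl⟩ _ ⟨y, hy, rfl⟩
    exact hF₁₂ x hx y hy
  have hFef := hFe.sumElim hFf hγ horth'
  -- Bessel's inequality for the normal directions in `F D₁ ⊕ F D₂`; components of `h` outside this
  -- sum are simply discarded.
  have bessel : ∀ v, (∑ i, γ v (s₁⁻¹ • F (e i)) ^ 2) + ∑ k, γ v (s₂⁻¹ • F (f k)) ^ 2 ≤ γ v v := by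
    intro v
    simpa using hFef.sum_sq_le hγ v
  have half₁ := half_estimate he hf F h B hs₁ hs₂ hC₁
  have half₂ := half_estimate hf he F h B hs₂ hs₁ hC₂
  set X := ∑ i, ∑ j, γ (h (e i) (e j)) (h (e i) (e j)) with hX
  set Y := ∑ i, ∑ k, γ (h (e i) (f k)) (h (e i) (f k)) with hY
  set Z := ∑ k, ∑ l, γ (h (f k) (f l)) (h (f k) (f l)) with hZ
  set a₁ := ∑ i, ∑ j, ∑ k, γ (h (e i) (e j)) (s₂⁻¹ • F (f k)) ^ 2 with ha₁
  set a₂ := ∑ i, ∑ j, ∑ k, γ (h (f i) (f j)) (s₁⁻¹ • F (e k)) ^ 2 with ha₂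
  set d₁ := ∑ i, ∑ j, ∑ k, γ (h (e i) (f k)) (s₁⁻¹ • F (e j)) ^ 2 with hd₁
  set d₂ := ∑ i, ∑ j, ∑ k, γ (h (f i) (e k)) (s₂⁻¹ • F (f j)) ^ 2 with hd₂
  -- By symmetry of `h` the mixed block occurs twice, which is where the weight `2` on `d²` comes
  -- from.
  have hnorm : normSq β γ (fun u v => h u v) = X + 2 * Y + Z := by
    rw [normSq_eq_sum hβ h hef]
    simp only [Fintype.sum_sum_type, Sum.elim_inl, Sum.elim_inr, Finset.sum_add_distrib,
      hsymm (f _) (e _)]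
    rw [Finset.sum_comm (f := fun i j => γ (h (e j) (f i)) (h (e j) (f i)))]
    ring
  have hR : R = (finrank ℝ D₁ : ℝ) / 4 * s₂ ^ 2 *
      (∑ k, γ B (s₂⁻¹ • F (f k)) * γ B (s₂⁻¹ • F (f k)))
      + s₂ * (∑ k, γ (∑ i, h (e i) (e i)) (s₂⁻¹ • F (f k)) * γ B (s₂⁻¹ • F (f k)))
      + ((finrank ℝ D₂ : ℝ) / 4 * s₁ ^ 2 *
      (∑ k, γ B (s₁⁻¹ • F (e k)) * γ B (s₁⁻¹ • F (e k)))
      + s₁ * ∑ k, γ (∑ i, h (f i) (f i)) (s₁⁻¹ • F (e k)) * γ B (s₁⁻¹ • F (e k))) := by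
    simp only [R, B₁, B₂, H₁, H₂, hFe.proj_proj hγ, hFf.proj_proj hγ, traceOn, hn₁, hn₂]
    push_cast
    ring
  simp only [Fintype.card_fin] at half₁ half₂
  have hXa : a₁ ≤ X := Finset.sum_le_sum fun i _ => Finset.sum_le_sum fun j _ =>
    (le_add_of_nonneg_left (Finset.sum_nonneg fun _ _ => sq_nonneg _)).trans (bessel _)
  have hZa : a₂ ≤ Z := Finset.sum_le_sum fun i _ => Finset.sum_le_sum fun j _ =>
    (le_add_of_nonneg_right (Finset.sum_nonneg fun _ _ => sq_nonneg _)).trans (bessel _)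
  -- The two halves share the mixed block without overlap: `d₁` uses its components in `F D₁` and
  -- `d₂` those in `F D₂`.
  have hYd : d₁ + d₂ ≤ Y := by
    have h1 : d₁ = ∑ i, ∑ k, ∑ j, γ (h (e i) (f k)) (s₁⁻¹ • F (e j)) ^ 2 :=
      Finset.sum_congr rfl fun i _ => Finset.sum_comm
    have h2 : d₂ = ∑ i, ∑ k, ∑ l, γ (h (e i) (f k)) (s₂⁻¹ • F (f l)) ^ 2 := by
      simp only [hd₂, hsymm (f _) (e _)]
      exact (Finset.sum_congr rfl fun i _ => Finset.sum_comm).trans Finset.sum_comm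
    rw [h1, h2, ← Finset.sum_add_distrib]
    refine Finset.sum_le_sum fun i _ => ?_
    rw [← Finset.sum_add_distrib]
    exact Finset.sum_le_sum fun k _ => bessel _
  have pa₁ : 0 ≤ a₁ := Finset.sum_nonneg fun _ _ => Finset.sum_nonneg fun _ _ =>
    Finset.sum_nonneg fun _ _ => sq_nonneg _
  have pa₂ : 0 ≤ a₂ := Finset.sum_nonneg fun _ _ => Finset.sum_nonneg fun _ _ =>
    Finset.sum_nonneg fun _ _ => sq_nonneg _
  have pd₁ : 0 ≤ d₁ := Finset.sum_nonneg fun _ _ => Finset.sum_nonneg fun _ _ =>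
    Finset.sum_nonneg fun _ _ => sq_nonneg _
  have pd₂ : 0 ≤ d₂ := Finset.sum_nonneg fun _ _ => Finset.sum_nonneg fun _ _ =>
    Finset.sum_nonneg fun _ _ => sq_nonneg _
  have main := combine_halves hs₁ hs₂ hs₁' hs₂' pa₁ pa₂ pd₁ pd₂ hXa hZa hYd half₁ half₂
  rw [← hnorm, ← hR] at main
  refine ⟨main.1, fun heq => ?_⟩
  have hall := main.2 heq
  rw [normSq_eq_sum hβ h hef] at hall
  have hz : ∀ i j, h (Sum.elim e f i) (Sum.elim e f j) = 0 := by
    intro i j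
    have h1 := (Finset.sum_eq_zero_iff_of_nonneg fun i _ =>
      Finset.sum_nonneg fun j _ => hγ.nonneg _).1 hall i (Finset.mem_univ _)
    exact hγ.eq_zero ((Finset.sum_eq_zero_iff_of_nonneg fun j _ => hγ.nonneg _).1 h1 j
      (Finset.mem_univ _))
  intro u v
  rw [hef.expand u trivial, hef.expand v trivial]
  simp only [map_sum, map_smul, LinearMap.sum_apply, LinearMap.smul_apply, hz]
  simp

end Inequality

/-! ### Differentiability of the metric and of `J` in charts -/

section Calculus

variable {D E F : Type*} [NormedAddCommGroup D] [NormedSpace ℝ D] [NormedAddCommGroup E]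
  [NormedSpace ℝ E] [FiniteDimensional ℝ E] [NormedAddCommGroup F] [NormedSpace ℝ F]

/-- Over a basis of the finite-dimensional `E`, `f` is a finite sum of fixed linear images of its
values `f y (b i)`. This reduces the operator-valued chart expressions to components, where
smoothness of bundle sections applies. -/
theorem differentiableAt_of_forall_apply {f : D → E →L[ℝ] F} {x : D}
    (h : ∀ v, DifferentiableAt ℝ (fun y => f y v) x) : DifferentiableAt ℝ f x := by
  let b := finBasis ℝ E
  have hf : f = fun y => ∑ i, ContinuousLinearMap.smulRightL ℝ E F
      (LinearMap.toContinuousLinearMap (b.coord i)) (f y (b i)) := by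
    funext y
    ext v
    conv_lhs => rw [← b.sum_repr v]
    simp only [map_sum, map_smul, sum_apply]
    rfl
  rw [hf]
  exact DifferentiableAt.fun_sum fun i _ =>
    (ContinuousLinearMap.differentiableAt _).comp x (h (b i))

end Calculus

section Ambient

variable {E : Type*} [NormedAddCommGroup E] [NormedSpace ℝ E]
  {N : Type*} [TopologicalSpace N] [ChartedSpace E N] [IsManifold 𝓘(ℝ, E) ∞ N]

theorem coordFrame_self (x : N) (v : E) : (coordFrame x x v : E) = v := by
  unfold coordFrame
  rw [TangentBundle.symmL_trivializationAt_eq_core (mem_chart_source E x)]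
  exact (tangentBundleCore 𝓘(ℝ, E) N).coordChange_self (achart E x) x (mem_chart_source E x) v

theorem coordComponents_self (x : N) (v : TangentSpace 𝓘(ℝ, E) x) :
    coordComponents x x v = (v : E) := by
  unfold coordComponents
  rw [TangentBundle.continuousLinearMapAt_trivializationAt_eq_core (mem_chart_source E x)]
  exact (tangentBundleCore 𝓘(ℝ, E) N).coordChange_self (achart E x) x (mem_chart_source E x) v

theorem coordFrame_coordComponents {x z : N} (hz : z ∈ (chartAt E x).source)
    (v : TangentSpace 𝓘(ℝ, E) z) : coordFrame x z (coordComponents x z v) = v :=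
  (trivializationAt E (TangentSpace 𝓘(ℝ, E) : N → Type _) x).symmL_continuousLinearMapAt hz v

theorem chartMetric_self (g : BilinField E N) (x : N) (a b : E) :
    chartMetric g x (extChartAt 𝓘(ℝ, E) x x) a b = g x a b := by
  -- The base point is made a variable because the tangent space depends on it; substitution then
  -- replaces a rewrite that would not typecheck.
  have h : ∀ z, z = x → g z (coordFrame x z a) (coordFrame x z b) = g x a b := by
    rintro z rfl
    exact congrArg₂ (fun u v => g z u v) (coordFrame_self z a) (coordFrame_self z b)
  exact h _ (extChartAt_to_inv x)

theorem chartEnd_self (J : EndField E N) (x : N) (a : E) :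
    chartEnd J x (extChartAt 𝓘(ℝ, E) x x) a = (J x a : E) := by
  have h : ∀ z, z = x → coordComponents x z (J z (coordFrame x z a)) = (J x a : E) := by
    rintro z rfl
    exact (coordComponents_self z _).trans (congrArg (fun u => J z u) (coordFrame_self z a))
  exact h _ (extChartAt_to_inv x)

theorem contMDiffAt_coordFrame (x : N) (v : E) :
    ContMDiffAt 𝓘(ℝ, E) (𝓘(ℝ, E).prod 𝓘(ℝ, E)) ∞
      (fun z => Bundle.TotalSpace.mk' E (E := (TangentSpace 𝓘(ℝ, E) : N → Type _)) z
        (coordFrame x z v)) x := by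
  have h := (trivializationAt E (TangentSpace 𝓘(ℝ, E) : N → Type _) x).contMDiffAt_symmL
    (IB := 𝓘(ℝ, E)) (n := ∞) (mem_chart_source E x)
  refine h.clm_bundle_apply (v := fun _ => v) ?_
  rw [Bundle.contMDiffAt_section]
  exact contMDiffAt_const

theorem contMDiffAt_inner_coordFrame (A : HermitianStructure E N) (x : N) (a b : E) :
    ContMDiffAt 𝓘(ℝ, E) 𝓘(ℝ, ℝ) ∞
      (fun z => A.g.inner z (coordFrame x z a) (coordFrame x z b)) x := by
  have : ContMDiffAt 𝓘(ℝ, E) (𝓘(ℝ, E).prod 𝓘(ℝ)) ∞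
      (fun z => Bundle.TotalSpace.mk' ℝ (E := Bundle.Trivial N ℝ) z
        (A.g.inner z (coordFrame x z a) (coordFrame x z b))) x :=
    ContMDiffAt.clm_bundle_apply₂ (F₁ := E) (F₂ := E) A.g.contMDiff.contMDiffAt
      (contMDiffAt_coordFrame x a) (contMDiffAt_coordFrame x b)
  simp only [Bundle.contMDiffAt_totalSpace] at this
  exact this.2

theorem contMDiffAt_coordComponents_coordFrame (A : HermitianStructure E N) (x : N) (a : E) :
    ContMDiffAt 𝓘(ℝ, E) 𝓘(ℝ, E) ∞
      (fun z => coordComponents x z (A.J z (coordFrame x z a))) x := by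
  have : ContMDiffAt 𝓘(ℝ, E) (𝓘(ℝ, E).prod 𝓘(ℝ, E)) ∞
      (fun z => Bundle.TotalSpace.mk' E (E := (TangentSpace 𝓘(ℝ, E) : N → Type _)) z
        (A.J z (coordFrame x z a))) x :=
    ContMDiffAt.clm_bundle_apply (F₁ := E) (F₂ := E) A.contMDiff_J.contMDiffAt
      (contMDiffAt_coordFrame x a)
  simp only [Bundle.contMDiffAt_totalSpace] at this
  refine this.2.congr_of_eventuallyEq ?_
  filter_upwards [(chartAt E x).open_source.mem_nhds (mem_chart_source E x)] with z hz
  have := (trivializationAt E (TangentSpace 𝓘(ℝ, E) : N → Type _) x).coe_linearMapAt_of_mem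
    (R := ℝ) (b := z) hz
  exact congrFun this _

theorem differentiableAt_comp_extChartAt_symm {F : Type*} [NormedAddCommGroup F] [NormedSpace ℝ F]
    {f : N → F} {x : N} (hf : ContMDiffAt 𝓘(ℝ, E) 𝓘(ℝ, F) ∞ f x) :
    DifferentiableAt ℝ (fun y => f ((extChartAt 𝓘(ℝ, E) x).symm y)) (extChartAt 𝓘(ℝ, E) x x) := by
  have h := (hf.mdifferentiableAt (by simp)).differentiableWithinAt_writtenInExtChartAt
  rw [writtenInExtChartAt, extChartAt_model_space_eq_id, modelWithCornersSelf_coe, range_id,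
    differentiableWithinAt_univ] at h
  exact h

variable [FiniteDimensional ℝ E]

theorem differentiableAt_chartMetric (A : HermitianStructure E N) (x : N) :
    DifferentiableAt ℝ (chartMetric (fun z => A.g.inner z) x) (extChartAt 𝓘(ℝ, E) x x) :=
  differentiableAt_of_forall_apply fun a => differentiableAt_of_forall_apply fun b =>
    differentiableAt_comp_extChartAt_symm (contMDiffAt_inner_coordFrame A x a b)

theorem differentiableAt_chartEnd (A : HermitianStructure E N) (x : N) :
    DifferentiableAt ℝ (chartEnd A.J x) (extChartAt 𝓘(ℝ, E) x x) :=
  differentiableAt_of_forall_apply fun a =>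
    differentiableAt_comp_extChartAt_symm (contMDiffAt_coordComponents_coordFrame A x a)

end Ambient

/-! ### Christoffel symbols, conformal change and the derivative of `J` -/

section Ambient

variable {E : Type*} [NormedAddCommGroup E] [NormedSpace ℝ E]
  {N : Type*} [TopologicalSpace N] [ChartedSpace E N] [IsManifold 𝓘(ℝ, E) ∞ N]

theorem HermitianStructure.isInnerProduct_form (A : HermitianStructure E N) (x : N) :
    IsInnerProduct (A.form x) :=
  ⟨fun u v => A.g.symm x u v, fun v hv => A.g.pos x v hv⟩

variable [FiniteDimensional ℝ E]

theorem riesz_toBilinForm_apply {G : E →L[ℝ] E →L[ℝ] ℝ} (hG : IsInnerProduct G.toBilinForm)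
    (κ : E →L[ℝ] ℝ) (c : E) : G (riesz G.toBilinForm (κ : E →ₗ[ℝ] ℝ)) c = κ c :=
  riesz_apply hG (κ : E →ₗ[ℝ] ℝ) c

theorem christoffel_spec {g : BilinField E N} {x : N}
    (hg : IsInnerProduct (g x).toBilinForm) (a b c : E) :
    g x (christoffel g x a b) c =
      1 / 2 * (fderiv ℝ (chartMetric g x) (extChartAt 𝓘(ℝ, E) x x) a b c
        + fderiv ℝ (chartMetric g x) (extChartAt 𝓘(ℝ, E) x x) b a c
        - fderiv ℝ (chartMetric g x) (extChartAt 𝓘(ℝ, E) x x) c a b) := by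
  refine (riesz_toBilinForm_apply (E := E) (G := g x) hg _ c).trans ?_
  simp

theorem fderiv_chartMetric_symm (A : HermitianStructure E N) (x : N) (a b c : E) :
    fderiv ℝ (chartMetric (fun z => A.g.inner z) x) (extChartAt 𝓘(ℝ, E) x x) a b c =
      fderiv ℝ (chartMetric (fun z => A.g.inner z) x) (extChartAt 𝓘(ℝ, E) x x) a c b := by
  have h := (differentiableAt_chartMetric A x).hasFDerivAt
  have h1 := (h.clm_apply (hasFDerivAt_const b _)).clm_apply (hasFDerivAt_const c _)
  have h2 := (h.clm_apply (hasFDerivAt_const c _)).clm_apply (hasFDerivAt_const b _)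
  have h3 : (fun y => chartMetric (fun z => A.g.inner z) x y b c) =
      fun y => chartMetric (fun z => A.g.inner z) x y c b :=
    funext fun y => A.g.symm _ _ _
  rw [h3] at h1
  simpa using congrArg (fun L => L a) (h1.unique h2)

/-- Compatibility of the Levi-Civita connection with the metric: in the sum of the two Koszul
formulas all other derivatives cancel by symmetry of the metric. -/
theorem fderiv_chartMetric (A : HermitianStructure E N) (x : N) (a b c : E) :
    fderiv ℝ (chartMetric (fun z => A.g.inner z) x) (extChartAt 𝓘(ℝ, E) x x) a b c =
      A.g.inner x (christoffel (fun z => A.g.inner z) x a b) c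
        + A.g.inner x (christoffel (fun z => A.g.inner z) x a c) b := by
  have h1 := christoffel_spec (g := fun z => A.g.inner z) (A.isInnerProduct_form x) a b c
  have h2 := christoffel_spec (g := fun z => A.g.inner z) (A.isInnerProduct_form x) a c b
  have h3 := fderiv_chartMetric_symm A x a b c
  have h4 := fderiv_chartMetric_symm A x b a c
  have h5 := fderiv_chartMetric_symm A x c a b
  linarith

/-- Vanishing torsion: the Koszul formula is symmetric in `a` and `b`. -/
theorem christoffel_comm (A : HermitianStructure E N) (x : N) (a b : E) :
    christoffel (fun z => A.g.inner z) x a b = christoffel (fun z => A.g.inner z) x b a := by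
  refine (A.isInnerProduct_form x).ext fun c => ?_
  have h1 := christoffel_spec (g := fun z => A.g.inner z) (A.isInnerProduct_form x) a b c
  have h2 := christoffel_spec (g := fun z => A.g.inner z) (A.isInnerProduct_form x) b a c
  have h5 := fderiv_chartMetric_symm A x c a b
  refine h1.trans (Eq.trans ?_ h2.symm)
  linarith

theorem mfderiv_apply_eq_fderiv {f : N → ℝ} {x : N} (hf : ContMDiffAt 𝓘(ℝ, E) 𝓘(ℝ, ℝ) ∞ f x)
    {η : E →L[ℝ] ℝ} (hη : η = mfderiv 𝓘(ℝ, E) 𝓘(ℝ, ℝ) f x) :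
    η = fderiv ℝ (fun y => f ((extChartAt 𝓘(ℝ, E) x).symm y)) (extChartAt 𝓘(ℝ, E) x x) := by
  have h := (hf.mdifferentiableAt (by simp)).mfderiv
  have h2 : fderivWithin ℝ (writtenInExtChartAt 𝓘(ℝ, E) 𝓘(ℝ, ℝ) x f) (range 𝓘(ℝ, E))
      (extChartAt 𝓘(ℝ, E) x x) =
      fderiv ℝ (fun y => f ((extChartAt 𝓘(ℝ, E) x).symm y)) (extChartAt 𝓘(ℝ, E) x x) := by
    rw [writtenInExtChartAt, extChartAt_model_space_eq_id, modelWithCornersSelf_coe, range_id,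
      fderivWithin_univ]
    rfl
  exact hη.trans (h.trans h2)

set_option synthInstance.maxHeartbeats 200000 in
/-- The derivative of a conformal metric. -/
theorem fderiv_chartMetric_conformal (A : HermitianStructure E N) {f : N → ℝ} {x : N}
    (hf : ContMDiffAt 𝓘(ℝ, E) 𝓘(ℝ, ℝ) ∞ f x)
    {η : E →L[ℝ] ℝ} (hη : η = mfderiv 𝓘(ℝ, E) 𝓘(ℝ, ℝ) f x) (a b c : E) :
    fderiv ℝ (chartMetric (fun z => Real.exp (-f z) • A.g.inner z) x)
        (extChartAt 𝓘(ℝ, E) x x) a b c =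
      Real.exp (-f x) * (fderiv ℝ (chartMetric (fun z => A.g.inner z) x)
        (extChartAt 𝓘(ℝ, E) x x) a b c - η a * A.g.inner x b c) := by
  have h1 := differentiableAt_chartMetric A x
  have h2 := (differentiableAt_comp_extChartAt_symm hf).neg.exp
  have h3 : DifferentiableAt ℝ (chartMetric (fun z => Real.exp (-f z) • A.g.inner z) x)
      (extChartAt 𝓘(ℝ, E) x x) :=
    differentiableAt_of_forall_apply fun a => differentiableAt_of_forall_apply fun b =>
      h2.mul ((h1.clm_apply (differentiableAt_const a)).clm_apply (differentiableAt_const b))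
  have h4 := ((h3.hasFDerivAt.clm_apply (hasFDerivAt_const b _)).clm_apply
    (hasFDerivAt_const c _)).unique
      ((differentiableAt_comp_extChartAt_symm hf).hasFDerivAt.neg.exp.mul
      ((h1.hasFDerivAt.clm_apply (hasFDerivAt_const b _)).clm_apply (hasFDerivAt_const c _)))
  have h5 := chartMetric_self (fun z => A.g.inner z) x b c
  have h6 := congrArg (fun L => L a) h4
  rw [mfderiv_apply_eq_fderiv hf hη, ← h5]
  simp only [add_apply, smul_apply, ContinuousLinearMap.comp_zero, zero_add,
    ContinuousLinearMap.flip_apply, neg_apply, smul_eq_mul] at h6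
  have h7 : Real.exp ((-fun y => f ((extChartAt 𝓘(ℝ, E) x).symm y)) (extChartAt 𝓘(ℝ, E) x x)) =
      Real.exp (-f x) := by
    rw [Pi.neg_apply, extChartAt_to_inv]
  rw [h7] at h6
  refine h6.trans ?_
  change _ + chartMetric (fun z => A.g.inner z) x (extChartAt 𝓘(ℝ, E) x x) b c * _ = _
  ring

/-- The Christoffel symbols of a conformal metric. -/
theorem christoffel_conformal (A : HermitianStructure E N) {f : N → ℝ} {x : N}
    (hf : ContMDiffAt 𝓘(ℝ, E) 𝓘(ℝ, ℝ) ∞ f x)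
    {η : E →L[ℝ] ℝ} (hη : η = mfderiv 𝓘(ℝ, E) 𝓘(ℝ, ℝ) f x) (a b c : E) :
    A.g.inner x (christoffel (fun z => Real.exp (-f z) • A.g.inner z) x a b) c =
      A.g.inner x (christoffel (fun z => A.g.inner z) x a b) c
        - 1 / 2 * (η a * A.g.inner x b c + η b * A.g.inner x a c - η c * A.g.inner x a b) := by
  have hexp : 0 < Real.exp (-f x) := Real.exp_pos _
  have hpos : IsInnerProduct (Real.exp (-f x) • A.g.inner x).toBilinForm := by
    refine ⟨fun u v => ?_, fun v hv => ?_⟩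
    · exact congrArg (Real.exp (-f x) * ·) (A.g.symm x u v)
    · exact mul_pos hexp (A.g.pos x v hv)
  have h1 := christoffel_spec (g := fun z => Real.exp (-f z) • A.g.inner z) hpos a b c
  have h2 := christoffel_spec (g := fun z => A.g.inner z) (A.isInnerProduct_form x) a b c
  rw [fderiv_chartMetric_conformal A hf hη, fderiv_chartMetric_conformal A hf hη,
    fderiv_chartMetric_conformal A hf hη] at h1
  apply mul_left_cancel₀ hexp.ne'
  refine Eq.trans h1 ?_
  rw [h2]
  ring

/-- The derivative of `J` in the preferred chart of a locally conformal Kähler manifold. -/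
theorem IsLCK.fderiv_chartEnd {A : HermitianStructure E N}
    {lee : ∀ x : N, TangentSpace 𝓘(ℝ, E) x →L[ℝ] ℝ} (hA : IsLCK A lee) (x : N) (a b c : E) :
    A.g.inner x (fderiv ℝ (chartEnd A.J x) (extChartAt 𝓘(ℝ, E) x x) a b) c =
      - A.g.inner x (christoffel (fun z => A.g.inner z) x a b) (A.J x c)
        - A.g.inner x (christoffel (fun z => A.g.inner z) x a (A.J x b)) c
        + 1 / 2 * (lee x (A.J x b) * A.g.inner x a c + A.g.inner x (A.J x a) b * lee x c
          - lee x b * A.g.inner x (A.J x a) c - A.g.inner x a b * lee x (A.J x c)) := by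
  obtain ⟨U, hU, hx, f, hf, hJ, hlee⟩ := hA x
  have hf' := hf.contMDiffAt (hU.mem_nhds hx)
  have hsk : ∀ u v : TangentSpace 𝓘(ℝ, E) x,
      A.g.inner x (A.J x u) v = - A.g.inner x u (A.J x v) := by
    intro u v
    rw [← A.compatible x u (A.J x v), A.J_sq, map_neg, neg_neg]
  have key := hJ x hx a b
  -- Pairing `J Γ(a,b)` with `c` moves `J` onto `c` by skew-symmetry, so the conformal correction is
  -- needed for `(a, b)` against `J c` and for `(a, J b)` against `c`. The two terms with `η a`
  -- cancel.
  have k1 := christoffel_conformal A hf' (hlee x hx) a b (A.J x c)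
  have k2 := christoffel_conformal A hf' (hlee x hx) a (A.J x b) c
  set Γ := christoffel (fun z => Real.exp (-f z) • A.g.inner z) x a b with hΓ
  set Γ' := christoffel (fun z => Real.exp (-f z) • A.g.inner z) x a (A.J x b) with hΓ'
  -- Parallelism of `J` for the local Kähler metric, solved for the coordinate derivative of `J`.
  have key2 : fderiv ℝ (chartEnd A.J x) (extChartAt 𝓘(ℝ, E) x x) a b = A.J x Γ - Γ' := by
    have aux : ∀ D Γ₁ Γ₂ : TangentSpace 𝓘(ℝ, E) x, D + Γ₂ - Γ₁ = 0 → D = Γ₁ - Γ₂ := by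
      intro D Γ₁ Γ₂ h
      rw [← sub_eq_zero, ← h]
      abel
    exact aux _ _ _ key
  have key3 : A.g.inner x (fderiv ℝ (chartEnd A.J x) (extChartAt 𝓘(ℝ, E) x x) a b) c =
      - A.g.inner x Γ (A.J x c) - A.g.inner x Γ' c := by
    rw [key2]
    refine (congrArg (fun L => L c) (map_sub (A.g.inner x) (A.J x Γ) Γ')).trans ?_
    exact congrArg (· - A.g.inner x Γ' c) (hsk _ _)
  rw [key3]
  have s1 := hsk a c
  have s2 := hsk a b
  have s3 := hsk b c
  linear_combination -k1 - k2 + 1 / 2 * lee x a * s3 + 1 / 2 * lee x b * s1 - 1 / 2 * lee x c * s2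

end Ambient

/-! ### Derivatives of the induced metric and two-form -/

section Calculus

variable {E E' : Type*} [NormedAddCommGroup E] [NormedSpace ℝ E] [NormedAddCommGroup E']
  [NormedSpace ℝ E']

set_option synthInstance.maxHeartbeats 200000 in
/-- The derivative of a pulled back bilinear form. -/
theorem hasFDerivAt_pullback {f : E' → E} {u : E'} (hf : ContDiffAt ℝ 2 f u)
    {G : E → E →L[ℝ] E →L[ℝ] ℝ} (hG : DifferentiableAt ℝ G (f u)) (a b : E') :
    ∃ L : E' →L[ℝ] ℝ, HasFDerivAt (fun y => G (f y) (fderiv ℝ f y a) (fderiv ℝ f y b)) L u ∧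
      ∀ v, L v = fderiv ℝ G (f u) (fderiv ℝ f u v) (fderiv ℝ f u a) (fderiv ℝ f u b)
        + G (f u) (fderiv ℝ (fderiv ℝ f) u v a) (fderiv ℝ f u b)
        + G (f u) (fderiv ℝ f u a) (fderiv ℝ (fderiv ℝ f) u v b) := by
  have h1 := (hf.differentiableAt (by norm_num)).hasFDerivAt
  have h2 := ((hf.fderiv_right (m := 1) (by norm_num)).differentiableAt (by norm_num)).hasFDerivAt
  have h5 : HasFDerivAt (fun y => G (f y)) ((fderiv ℝ G (f u)).comp (fderiv ℝ f u)) u :=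
    HasFDerivAt.comp (G := E →L[ℝ] E →L[ℝ] ℝ) u hG.hasFDerivAt h1
  have h6 := h5.clm_apply (h2.clm_apply (hasFDerivAt_const a u))
  have h3 := h6.clm_apply (h2.clm_apply (hasFDerivAt_const b u))
  refine ⟨_, h3, fun v => ?_⟩
  simp
  ring

set_option synthInstance.maxHeartbeats 200000 in
/-- The derivative of a pulled back bilinear form composed with an endomorphism. -/
theorem hasFDerivAt_pullback_comp {f : E' → E} {u : E'} (hf : ContDiffAt ℝ 2 f u)
    {G : E → E →L[ℝ] E →L[ℝ] ℝ} (hG : DifferentiableAt ℝ G (f u))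
    {K : E → E →L[ℝ] E} (hK : DifferentiableAt ℝ K (f u)) (a b : E') :
    ∃ L : E' →L[ℝ] ℝ,
      HasFDerivAt (fun y => G (f y) (K (f y) (fderiv ℝ f y a)) (fderiv ℝ f y b)) L u ∧
      ∀ v, L v = fderiv ℝ G (f u) (fderiv ℝ f u v) (K (f u) (fderiv ℝ f u a)) (fderiv ℝ f u b)
        + G (f u) (fderiv ℝ K (f u) (fderiv ℝ f u v) (fderiv ℝ f u a)) (fderiv ℝ f u b)
        + G (f u) (K (f u) (fderiv ℝ (fderiv ℝ f) u v a)) (fderiv ℝ f u b)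
        + G (f u) (K (f u) (fderiv ℝ f u a)) (fderiv ℝ (fderiv ℝ f) u v b) := by
  have h1 := (hf.differentiableAt (by norm_num)).hasFDerivAt
  have h2 := ((hf.fderiv_right (m := 1) (by norm_num)).differentiableAt (by norm_num)).hasFDerivAt
  have h4 := (hK.hasFDerivAt.comp u h1).clm_apply (h2.clm_apply (hasFDerivAt_const a u))
  have h5 : HasFDerivAt (fun y => G (f y)) ((fderiv ℝ G (f u)).comp (fderiv ℝ f u)) u :=
    HasFDerivAt.comp (G := E →L[ℝ] E →L[ℝ] ℝ) u hG.hasFDerivAt h1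
  have h6 := h5.clm_apply h4
  have h3 := h6.clm_apply (h2.clm_apply (hasFDerivAt_const b u))
  refine ⟨_, h3, fun v => ?_⟩
  simp
  ring

end Calculus

section Submanifold

variable {E : Type*} [NormedAddCommGroup E] [NormedSpace ℝ E] [FiniteDimensional ℝ E]
  {N : Type*} [TopologicalSpace N] [ChartedSpace E N] [IsManifold 𝓘(ℝ, E) ∞ N]
  {E' H : Type*} [NormedAddCommGroup E'] [NormedSpace ℝ E'] [TopologicalSpace H]
  {I : ModelWithCorners ℝ E' H} [I.Boundaryless]
  {M : Type*} [TopologicalSpace M] [ChartedSpace H M] [IsManifold I ∞ M]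
  (A : HermitianStructure E N) {φ : M → N}

theorem contDiffAt_writtenInExtChartAt (hφ : ContMDiff I 𝓘(ℝ, E) ∞ φ) (p : M) :
    ContDiffAt ℝ ∞ (writtenInExtChartAt I 𝓘(ℝ, E) p φ) (extChartAt I p p) := by
  have h := (contMDiffAt_iff.1 (hφ p)).2
  rwa [I.range_eq_univ, contDiffWithinAt_univ] at h

theorem fderiv_writtenInExtChartAt (hφ : ContMDiff I 𝓘(ℝ, E) ∞ φ) (p : M) :
    fderiv ℝ (writtenInExtChartAt I 𝓘(ℝ, E) p φ) (extChartAt I p p) =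
      mfderiv I 𝓘(ℝ, E) φ p := by
  have h := ((hφ p).mdifferentiableAt (by simp)).mfderiv
  rw [I.range_eq_univ, fderivWithin_univ] at h
  exact h.symm

theorem writtenInExtChartAt_self (p : M) :
    writtenInExtChartAt I 𝓘(ℝ, E) p φ (extChartAt I p p) = extChartAt 𝓘(ℝ, E) (φ p) (φ p) := by
  simp [writtenInExtChartAt]

/-- The components of the induced metric in the charts at `p` and `φ p`. -/
noncomputable def chartInduced (φ : M → N) (p : M) (u a b : E') : ℝ :=
  let f := writtenInExtChartAt I 𝓘(ℝ, E) p φ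
  chartMetric (fun z => A.g.inner z) (φ p) (f u) (fderiv ℝ f u a) (fderiv ℝ f u b)

/-- The components of the induced fundamental two-form in the charts at `p` and `φ p`. -/
noncomputable def chartTwoForm (φ : M → N) (p : M) (u a b : E') : ℝ :=
  let f := writtenInExtChartAt I 𝓘(ℝ, E) p φ
  chartMetric (fun z => A.g.inner z) (φ p) (f u) (chartEnd A.J (φ p) (f u) (fderiv ℝ f u a))
    (fderiv ℝ f u b)

theorem form_covDeriv (p : M) (v a : E') (c : E) :
    A.form (φ p) (covDeriv I A φ p v a) c =
      A.g.inner (φ p) (fderiv ℝ (fderiv ℝ (writtenInExtChartAt I 𝓘(ℝ, E) p φ))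
        (extChartAt I p p) v a) c
      + A.g.inner (φ p) (christoffel (fun x => A.g.inner x) (φ p)
        (mfderiv I 𝓘(ℝ, E) φ p v) (mfderiv I 𝓘(ℝ, E) φ p a)) c :=
  congrArg (fun L => L c) (map_add (A.g.inner (φ p)) _ _)

/-- Compatibility with the metric along `φ`: the second derivatives of `φ` from the product rule and
the Christoffel terms from the ambient metric combine into `covDeriv`. -/
theorem hasFDerivAt_chartInduced (hφ : ContMDiff I 𝓘(ℝ, E) ∞ φ) (p : M) (a b : E') :
    ∃ L : E' →L[ℝ] ℝ,
      HasFDerivAt (fun u => chartInduced (I := I) A φ p u a b) L (extChartAt I p p) ∧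
      ∀ v : E', L v = A.form (φ p) (covDeriv I A φ p v a) (mfderiv I 𝓘(ℝ, E) φ p b)
        + A.form (φ p) (covDeriv I A φ p v b) (mfderiv I 𝓘(ℝ, E) φ p a) := by
  have hf := (contDiffAt_writtenInExtChartAt hφ p).of_le (m := 2) (by norm_cast)
  have hG := differentiableAt_chartMetric A (φ p)
  rw [← writtenInExtChartAt_self (I := I) (φ := φ) p] at hG
  obtain ⟨L, hL, hLv⟩ := hasFDerivAt_pullback hf hG a b
  refine ⟨L, hL, fun v => ?_⟩
  rw [hLv, writtenInExtChartAt_self, fderiv_chartMetric, chartMetric_self, chartMetric_self,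
    fderiv_writtenInExtChartAt hφ]
  have h1 := form_covDeriv (I := I) A (φ := φ) p v a (mfderiv I 𝓘(ℝ, E) φ p b)
  have h2 := form_covDeriv (I := I) A (φ := φ) p v b (mfderiv I 𝓘(ℝ, E) φ p a)
  have h := A.g.symm (φ p) (mfderiv I 𝓘(ℝ, E) φ p a)
    (fderiv ℝ (fderiv ℝ (writtenInExtChartAt I 𝓘(ℝ, E) p φ)) (extChartAt I p p) v b)
  linear_combination h - h1 - h2

/-- The product rule for `γ(J dφ a, dφ b)`. The bracket with factor `1 / 2` is `γ((∇ᵥJ) a, b)`,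
expressed by the Lee form through `IsLCK.fderiv_chartEnd`. -/
theorem hasFDerivAt_chartTwoForm {lee : ∀ x : N, TangentSpace 𝓘(ℝ, E) x →L[ℝ] ℝ}
    (hA : IsLCK A lee) (hφ : ContMDiff I 𝓘(ℝ, E) ∞ φ) (p : M) (a b : E') :
    ∃ L : E' →L[ℝ] ℝ,
      HasFDerivAt (fun u => chartTwoForm (I := I) A φ p u a b) L (extChartAt I p p) ∧
      ∀ v : E', L v =
        A.form (φ p) (covDeriv I A φ p v b) (A.J (φ p) (mfderiv I 𝓘(ℝ, E) φ p a))
        - A.form (φ p) (covDeriv I A φ p v a) (A.J (φ p) (mfderiv I 𝓘(ℝ, E) φ p b))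
        + 1 / 2 * (lee (φ p) (A.J (φ p) (mfderiv I 𝓘(ℝ, E) φ p a)) *
            A.form (φ p) (mfderiv I 𝓘(ℝ, E) φ p v) (mfderiv I 𝓘(ℝ, E) φ p b)
          + A.form (φ p) (A.J (φ p) (mfderiv I 𝓘(ℝ, E) φ p v)) (mfderiv I 𝓘(ℝ, E) φ p a) *
            lee (φ p) (mfderiv I 𝓘(ℝ, E) φ p b)
          - lee (φ p) (mfderiv I 𝓘(ℝ, E) φ p a) *
            A.form (φ p) (A.J (φ p) (mfderiv I 𝓘(ℝ, E) φ p v)) (mfderiv I 𝓘(ℝ, E) φ p b)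
          - A.form (φ p) (mfderiv I 𝓘(ℝ, E) φ p v) (mfderiv I 𝓘(ℝ, E) φ p a) *
            lee (φ p) (A.J (φ p) (mfderiv I 𝓘(ℝ, E) φ p b))) := by
  have hf := (contDiffAt_writtenInExtChartAt hφ p).of_le (m := 2) (by norm_cast)
  have hG := differentiableAt_chartMetric A (φ p)
  have hK := differentiableAt_chartEnd A (φ p)
  rw [← writtenInExtChartAt_self (I := I) (φ := φ) p] at hG hK
  obtain ⟨L, hL, hLv⟩ := hasFDerivAt_pullback_comp hf hG hK a b
  refine ⟨L, hL, fun v => ?_⟩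
  rw [hLv, writtenInExtChartAt_self, fderiv_chartMetric]
  simp only [chartMetric_self, chartEnd_self]
  rw [hA.fderiv_chartEnd, fderiv_writtenInExtChartAt hφ]
  have h3 := form_covDeriv (I := I) A (φ := φ) p v b (A.J (φ p) (mfderiv I 𝓘(ℝ, E) φ p a))
  have h4 := form_covDeriv (I := I) A (φ := φ) p v a (A.J (φ p) (mfderiv I 𝓘(ℝ, E) φ p b))
  have h5 := chartMetric_self (fun z => A.g.inner z) (φ p) (A.J (φ p) (fderiv ℝ (fderiv ℝ
    (writtenInExtChartAt I 𝓘(ℝ, E) p φ)) (extChartAt I p p) v a)) (mfderiv I 𝓘(ℝ, E) φ p b)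
  have h6 := chartMetric_self (fun z => A.g.inner z) (φ p) (A.J (φ p) (mfderiv I 𝓘(ℝ, E) φ p a))
    (fderiv ℝ (fderiv ℝ (writtenInExtChartAt I 𝓘(ℝ, E) p φ)) (extChartAt I p p) v b)
  set D := fderiv ℝ (fderiv ℝ (writtenInExtChartAt I 𝓘(ℝ, E) p φ)) (extChartAt I p p)
  have h := A.g.symm (φ p) (A.J (φ p) (mfderiv I 𝓘(ℝ, E) φ p a)) (D v b)
  have h2 : A.g.inner (φ p) (A.J (φ p) (D v a)) (mfderiv I 𝓘(ℝ, E) φ p b) =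
      - A.g.inner (φ p) (D v a) (A.J (φ p) (mfderiv I 𝓘(ℝ, E) φ p b)) := by
    rw [← A.compatible (φ p) (D v a), A.J_sq, map_neg, neg_neg]
  have hform : ∀ u v, A.form (φ p) u v = A.g.inner (φ p) u v := fun _ _ => rfl
  simp only [hform] at h3 h4 ⊢
  linear_combination h + h2 + h5 + h6 - h3 + h4

/-- Second derivatives commute and the connection has no torsion. -/
theorem covDeriv_comm (hφ : ContMDiff I 𝓘(ℝ, E) ∞ φ) (p : M) (a b : TangentSpace I p) :
    covDeriv I A φ p a b = covDeriv I A φ p b a := by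
  have hf := contDiffAt_writtenInExtChartAt hφ p
  have h := (hf.isSymmSndFDerivAt (by simp; norm_cast)).eq a b
  exact congrArg₂ (fun x y : E => x + y) h (christoffel_comm A (φ p) _ _)

end Submanifold

/-! ### The Codazzi-type identity as linear algebra at a point -/

section PointwiseAlgebra

variable {V : Type*} [AddCommGroup V] [Module ℝ V] [FiniteDimensional ℝ V]
  {T : Type*} [AddCommGroup T] [Module ℝ T]

/-- The Codazzi-type identity for a pair of complementary distributions `K`, `K'` on a submanifold
of a locally conformal Kähler manifold. Here `c` is the ambient covariant derivative, `dm` and `dΩ`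
are the derivatives of the metric and of the fundamental two-form in a chart, and `η` is the Lee
form. -/
theorem codazzi_of_derivatives {β : LinearMap.BilinForm ℝ V} {γ : LinearMap.BilinForm ℝ T}
    (hβ : IsInnerProduct β) (hγ : IsInnerProduct γ) (i : V →ₗ[ℝ] T) (J : T →ₗ[ℝ] T)
    (hJ : ∀ u v, γ (J u) v = - γ u (J v)) (hi : ∀ u v, β u v = γ (i u) (i v))
    {c h : V → V → T} {τ : V → V → V} {F : V → T} {P : V → V}
    (hc : ∀ u v, c u v = c v u) (hsym : ∀ u v, h u v = h v u)
    (hτ : ∀ u v, c u v = h u v + i (τ u v))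
    (hP : ∀ u, J (i u) = F u + i (P u)) (hF : ∀ u v, γ (i v) (F u) = 0)
    (η : T →ₗ[ℝ] ℝ)
    {dm dΩ : V → V → V → ℝ}
    (hdm : ∀ u v w, dm u v w = γ (c u v) (i w) + γ (c u w) (i v))
    (hdΩ : ∀ u v w, dΩ u v w = γ (c u w) (J (i v)) - γ (c u v) (J (i w))
      + 1 / 2 * (η (J (i v)) * β u w + γ (J (i u)) (i v) * η (i w)
        - η (i v) * γ (J (i u)) (i w) - β u v * η (J (i w))))
    {K K' : Submodule ℝ V} (horth : ∀ x ∈ K, ∀ z ∈ K', β x z = 0)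
    (hPK : ∀ x ∈ K, P x ∈ K) (hPK' : ∀ z ∈ K', P z ∈ K') {κ : V → ℝ}
    (hm₁ : ∀ x ∈ K, ∀ y ∈ K, ∀ z ∈ K', dm x y z = 0)
    (hm₂ : ∀ x ∈ K, ∀ y ∈ K, ∀ z ∈ K', dm z x y = 2 * κ z * β x y)
    (hΩ : ∀ x ∈ K, ∀ y ∈ K, ∀ z ∈ K', dΩ x y z = 0)
    {q : ℝ} (hq : q ≠ 0) (hPP : ∀ x ∈ K, β (P x) (P x) = q * β x x)
    (hsum : ∀ x ∈ K, ∀ z ∈ K', ∑ k, β (P x) (frame β K k) * dΩ z x (frame β K k) =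
      2 * κ z * q * β x x) :
    ∀ x ∈ K, ∀ y ∈ K, ∀ z ∈ K',
      γ (h x y) (F z) + 1 / 2 * β x y * η (F z) = γ (h x z) (F y) := by
  have hΩP : ∀ u v, γ (J (i u)) (i v) = β (P u) v := by
    intro u v
    rw [hP, map_add, LinearMap.add_apply, hγ.1 (F u), hF, hi]
    ring
  have hskew : ∀ u v, β u (P v) = - β (P u) v := by
    intro u v
    rw [← hΩP, hβ.1, ← hΩP, hJ, hγ.1]
  have hcJ : ∀ u v w, γ (c u v) (J (i w)) = γ (h u v) (F w) + γ (c u v) (i (P w)) := by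
    intro u v w
    rw [hP, map_add, hτ, map_add, LinearMap.add_apply, hF]
    simp
  have hηJ : ∀ w, η (J (i w)) = η (F w) + η (i (P w)) := fun w => by rw [hP, map_add]
  -- Koszul's argument: the three derivatives of the induced metric among `x`, `y`, `z` determine
  -- the tangential components of `c`.
  have c₁ : ∀ x ∈ K, ∀ y ∈ K, ∀ z ∈ K', γ (c x y) (i z) = - (κ z * β x y) := by
    intro x hx y hy z hz
    have e₁ := hm₁ x hx y hy z hz
    have e₂ := hm₁ y hy x hx z hz
    have e₃ := hm₂ x hx y hy z hz
    rw [hdm] at e₁ e₂ e₃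
    rw [hc y x, hc y z] at e₂
    rw [hc x z] at e₁
    linarith
  have c₂ : ∀ x ∈ K, ∀ y ∈ K, ∀ z ∈ K', γ (c x z) (i y) = κ z * β x y := by
    intro x hx y hy z hz
    have e₁ := hm₁ x hx y hy z hz
    rw [hdm, c₁ x hx y hy z hz] at e₁
    linarith
  -- The derivative along `x` of `Ω(y, z) = 0`. The identity is reached except for two multiples of
  -- the defect `½η - κ`.
  have key : ∀ x ∈ K, ∀ y ∈ K, ∀ z ∈ K', γ (h x y) (F z) + 1 / 2 * β x y * η (F z) =
      γ (h x z) (F y) + (1 / 2 * η (i z) - κ z) * β (P x) y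
        - (1 / 2 * η (i (P z)) - κ (P z)) * β x y := by
    intro x hx y hy z hz
    have e := hΩ x hx y hy z hz
    rw [hdΩ, hcJ, hcJ, c₁ x hx y hy (P z) (hPK' z hz), c₂ x hx (P y) (hPK y hy) z hz,
      horth x hx z hz, hΩP, hΩP, horth (P x) (hPK x hx) z hz, hskew, hηJ z] at e
    linarith
  -- Exchanging `x` and `y` in `key` and subtracting removes the terms symmetric in `x` and `y`.
  -- What remains evaluates the difference of `h`-terms in the derivative of `Ω(x, y)` along `z`.
  have hdZ : ∀ x ∈ K, ∀ y ∈ K, ∀ z ∈ K', dΩ z x y = η (i z) * β (P x) y := by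
    intro x hx y hy z hz
    have k₁ := key x hx y hy z hz
    have k₂ := key y hy x hx z hz
    rw [hsym y x, hβ.1 y x, hsym y z] at k₂
    rw [hsym x z] at k₁
    have e : β (P y) x = - β (P x) y := by rw [← hskew, hβ.1]
    have e' : β y (P x) = β (P x) y := hβ.1 _ _
    rw [hdΩ, hcJ, hcJ, hc z y, hc z x, c₂ y hy (P x) (hPK x hx) z hz,
      c₂ x hx (P y) (hPK y hy) z hz, hβ.1 z y, hβ.1 z x, horth x hx z hz, horth y hy z hz, hΩP, hΩP,
      hβ.1 _ x, hβ.1 _ y, horth x hx _ (hPK' z hz), horth y hy _ (hPK' z hz), hskew x y, e']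
    rw [e] at k₂
    linarith
  intro x hx y hy z hz
  -- The case `x = 0` is separate because `η z` is found by cancelling `β x x`. Linearity of `h` is
  -- not assumed here, so `key` is used there too.
  by_cases hx0 : x = 0
  · have hx' : ∀ z ∈ K', γ (h x y) (F z) = γ (h x z) (F y) := by
      intro z hz
      have := key x hx y hy z hz
      have hPx : P x = 0 := hβ.eq_zero (by rw [hPP x hx, hx0]; simp)
      rw [hPx] at this
      simpa [hx0] using this
    rw [hx' z hz, hx0]
    simp
  · have hfr := frame_isFrame hβ K
    -- Pairing `hdZ` with `P x` gives `η(z) |Px|² = η(z) q |x|²`, while the constant slant angle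
    -- gives `2κ(z) q |x|²`.
    have lee : ∀ z ∈ K', η (i z) = 2 * κ z := by
      intro z hz
      have e := hsum x hx z hz
      have e₂ : ∑ k, β (P x) (frame β K k) * dΩ z x (frame β K k) = η (i z) * (q * β x x) := by
        rw [← hPP x hx, hfr.parseval hβ (hPK x hx), Finset.mul_sum]
        refine Finset.sum_congr rfl fun k _ => ?_
        rw [hdZ x hx _ (hfr.mem k) z hz]
        ring
      rw [e₂, mul_assoc (2 * κ z)] at e
      exact mul_right_cancel₀ (mul_ne_zero hq (hβ.2 x hx0).ne') e
    rw [key x hx y hy z hz, lee z hz, lee _ (hPK' z hz)]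
    ring

end PointwiseAlgebra

/-! ### Linearity of tangential and normal parts, `F`, `P` and `h` -/

section Submanifold

variable {E : Type*} [NormedAddCommGroup E] [NormedSpace ℝ E] [FiniteDimensional ℝ E]
  {N : Type*} [TopologicalSpace N] [ChartedSpace E N] [IsManifold 𝓘(ℝ, E) ∞ N]
  {E' H : Type*} [NormedAddCommGroup E'] [NormedSpace ℝ E'] [FiniteDimensional ℝ E']
  [TopologicalSpace H] {I : ModelWithCorners ℝ E' H} [I.Boundaryless]
  {M : Type*} [TopologicalSpace M] [ChartedSpace H M] [IsManifold I ∞ M]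
  (A : HermitianStructure E N) {φ : M → N} {p : M}

instance finiteDimensional_tangentSpace (x : M) : FiniteDimensional ℝ (TangentSpace I x) :=
  inferInstanceAs (FiniteDimensional ℝ E')

theorem HermitianStructure.form_J (x : N) (u v : TangentSpace 𝓘(ℝ, E) x) :
    A.form x (A.J x u) v = - A.form x u (A.J x v) := by
  have h := A.compatible x u (A.J x v)
  rw [A.J_sq, map_neg] at h
  exact (by linarith : A.g.inner x (A.J x u) v = - A.g.inner x u (A.J x v))

theorem form_tangentPart (hp : IsInnerProduct (inducedForm I A φ p))
    (ξ : TangentSpace 𝓘(ℝ, E) (φ p)) (v : TangentSpace I p) :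
    A.form (φ p) (mfderiv I 𝓘(ℝ, E) φ p (tangentPart I A φ p ξ)) (mfderiv I 𝓘(ℝ, E) φ p v) =
      A.form (φ p) ξ (mfderiv I 𝓘(ℝ, E) φ p v) :=
  riesz_apply hp _ v

theorem form_normalPart (hp : IsInnerProduct (inducedForm I A φ p))
    (ξ : TangentSpace 𝓘(ℝ, E) (φ p)) (v : TangentSpace I p) :
    A.form (φ p) (normalPart I A φ p ξ) (mfderiv I 𝓘(ℝ, E) φ p v) = 0 := by
  rw [normalPart, map_sub, LinearMap.sub_apply, form_tangentPart A hp, sub_self]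

theorem tangentPart_add (hp : IsInnerProduct (inducedForm I A φ p))
    (ξ ζ : TangentSpace 𝓘(ℝ, E) (φ p)) :
    tangentPart I A φ p (ξ + ζ) = tangentPart I A φ p ξ + tangentPart I A φ p ζ := by
  refine hp.ext fun v => ?_
  rw [map_add, LinearMap.add_apply]
  refine (form_tangentPart A hp _ v).trans ?_
  rw [map_add, LinearMap.add_apply]
  exact (congrArg₂ (· + ·) (form_tangentPart A hp _ v) (form_tangentPart A hp _ v)).symm

theorem tangentPart_smul (hp : IsInnerProduct (inducedForm I A φ p)) (r : ℝ)
    (ξ : TangentSpace 𝓘(ℝ, E) (φ p)) :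
    tangentPart I A φ p (r • ξ) = r • tangentPart I A φ p ξ := by
  refine hp.ext fun v => ?_
  rw [map_smul, LinearMap.smul_apply]
  refine (form_tangentPart A hp _ v).trans ?_
  rw [map_smul, LinearMap.smul_apply]
  exact (congrArg (r • ·) (form_tangentPart A hp _ v)).symm

/-- The normal part as a linear map. -/
noncomputable def normalPartₗ (hp : IsInnerProduct (inducedForm I A φ p)) :
    TangentSpace 𝓘(ℝ, E) (φ p) →ₗ[ℝ] TangentSpace 𝓘(ℝ, E) (φ p) where
  toFun := normalPart I A φ p
  map_add' ξ ζ := by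
    simp only [normalPart, tangentPart_add A hp, map_add]
    abel
  map_smul' r ξ := by
    simp only [normalPart, tangentPart_smul A hp, map_smul, RingHom.id_apply, smul_sub]

/-- `F` as a linear map. -/
noncomputable def Fₗ (hp : IsInnerProduct (inducedForm I A φ p)) :
    TangentSpace I p →ₗ[ℝ] TangentSpace 𝓘(ℝ, E) (φ p) :=
  normalPartₗ A hp ∘ₗ (A.J (φ p)).toLinearMap ∘ₗ (mfderiv I 𝓘(ℝ, E) φ p).toLinearMap

/-- `P` as a linear map. -/
noncomputable def Pₗ (hp : IsInnerProduct (inducedForm I A φ p)) :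
    TangentSpace I p →ₗ[ℝ] TangentSpace I p where
  toFun := P I A φ p
  map_add' u v := by
    simp only [P, tangentPart_add A hp, map_add]
  map_smul' r u := by
    simp only [P, tangentPart_smul A hp, map_smul, RingHom.id_apply]

set_option synthInstance.maxHeartbeats 200000 in
theorem christoffel_add (x : N) (a a' b : E) :
    (christoffel (fun z => A.g.inner z) x (a + a' : E) b : E) =
      (christoffel (fun z => A.g.inner z) x a b : E)
        + (christoffel (fun z => A.g.inner z) x a' b : E) := by
  refine (A.isInnerProduct_form x).ext fun (c : E) => ?_
  have h₀ := christoffel_spec (g := fun z => A.g.inner z) (A.isInnerProduct_form x) (a + a' : E) b c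
  have h₁ := christoffel_spec (g := fun z => A.g.inner z) (A.isInnerProduct_form x) a b c
  have h₂ := christoffel_spec (g := fun z => A.g.inner z) (A.isInnerProduct_form x) a' b c
  refine h₀.trans (Eq.trans ?_ (congrArg (fun L => L c) (map_add (A.g.inner x) _ _)).symm)
  refine Eq.trans ?_ (congrArg₂ (· + ·) h₁ h₂).symm
  simp only [map_add, add_apply]
  ring

set_option synthInstance.maxHeartbeats 200000 in
theorem christoffel_smul (x : N) (r : ℝ) (a b : E) :
    (christoffel (fun z => A.g.inner z) x (r • a : E) b : E) =
      r • (christoffel (fun z => A.g.inner z) x a b : E) := by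
  refine (A.isInnerProduct_form x).ext fun (c : E) => ?_
  have h₀ := christoffel_spec (g := fun z => A.g.inner z) (A.isInnerProduct_form x) (r • a : E) b c
  have h₁ := christoffel_spec (g := fun z => A.g.inner z) (A.isInnerProduct_form x) a b c
  refine h₀.trans (Eq.trans ?_ (congrArg (fun L => L c) (map_smul (A.g.inner x) r _)).symm)
  refine Eq.trans ?_ (congrArg (r • ·) h₁).symm
  simp only [map_smul, smul_apply, smul_eq_mul]
  ring

theorem covDeriv_add (u v w : TangentSpace I p) :
    covDeriv I A φ p (u + v) w = covDeriv I A φ p u w + covDeriv I A φ p v w := by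
  set D : E' →L[ℝ] E' →L[ℝ] E := fderiv ℝ (fderiv ℝ (writtenInExtChartAt I 𝓘(ℝ, E) p φ))
    (extChartAt I p p) with hD
  set L : E' →L[ℝ] E := mfderiv I 𝓘(ℝ, E) φ p with hL
  let Γ : E → E → E := fun a b => christoffel (fun z => A.g.inner z) (φ p) a b
  have hΓ : ∀ a a' b, Γ (a + a') b = Γ a b + Γ a' b := christoffel_add A (φ p)
  have aux : ∀ u v w : E', D (u + v) w + Γ (L (u + v)) (L w) =
      D u w + Γ (L u) (L w) + (D v w + Γ (L v) (L w)) := by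
    intro u v w
    rw [map_add, map_add, hΓ, add_apply]
    abel
  exact aux u v w

theorem covDeriv_smul (r : ℝ) (u w : TangentSpace I p) :
    covDeriv I A φ p (r • u) w = r • covDeriv I A φ p u w := by
  set D : E' →L[ℝ] E' →L[ℝ] E := fderiv ℝ (fderiv ℝ (writtenInExtChartAt I 𝓘(ℝ, E) p φ))
    (extChartAt I p p) with hD
  set L : E' →L[ℝ] E := mfderiv I 𝓘(ℝ, E) φ p with hL
  let Γ : E → E → E := fun a b => christoffel (fun z => A.g.inner z) (φ p) a b
  have hΓ : ∀ r a b, Γ (r • a) b = r • Γ a b := christoffel_smul A (φ p)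
  have aux : ∀ u w : E', D (r • u) w + Γ (L (r • u)) (L w) = r • (D u w + Γ (L u) (L w)) := by
    intro u w
    rw [map_smul, map_smul, hΓ, smul_apply, smul_add]
  exact aux u w

/-- The second fundamental form as a bilinear map. -/
noncomputable def sffₗ (hφ : ContMDiff I 𝓘(ℝ, E) ∞ φ) (hp : IsInnerProduct (inducedForm I A φ p)) :
    TangentSpace I p →ₗ[ℝ] TangentSpace I p →ₗ[ℝ] TangentSpace 𝓘(ℝ, E) (φ p) :=
  LinearMap.mk₂ ℝ (sff I A φ p)
    (fun u v w => by
      rw [sff, covDeriv_add]; exact (normalPartₗ A hp).map_add _ _)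
    (fun r u w => by
      rw [sff, covDeriv_smul]; exact (normalPartₗ A hp).map_smul _ _)
    -- Linearity in the second slot is transported from the first by symmetry.
    (fun u v w => by
      rw [sff, covDeriv_comm A hφ, covDeriv_add, covDeriv_comm A hφ p v, covDeriv_comm A hφ p w]
      exact (normalPartₗ A hp).map_add _ _)
    (fun r u w => by
      rw [sff, covDeriv_comm A hφ, covDeriv_smul, covDeriv_comm A hφ p w]
      exact (normalPartₗ A hp).map_smul _ _)

end Submanifold

/-! ### Intrinsic meaning of the chart expressions at nearby points -/

section Submanifold

variable {E : Type*} [NormedAddCommGroup E] [NormedSpace ℝ E]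
  {N : Type*} [TopologicalSpace N] [ChartedSpace E N] [IsManifold 𝓘(ℝ, E) ∞ N]
  {E' H : Type*} [NormedAddCommGroup E'] [NormedSpace ℝ E']
  [TopologicalSpace H] {I : ModelWithCorners ℝ E' H} [I.Boundaryless]
  {M : Type*} [TopologicalSpace M] [ChartedSpace H M] [IsManifold I ∞ M]

theorem chartMetric_extChartAt (g : BilinField E N) {x z : N} (hz : z ∈ (chartAt E x).source)
    (v w : TangentSpace 𝓘(ℝ, E) z) :
    chartMetric g x (extChartAt 𝓘(ℝ, E) x z) (coordComponents x z v) (coordComponents x z w) =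
      g z v w := by
  have h : ∀ z', z' = z → ∀ a b : E, g z' (coordFrame x z' a) (coordFrame x z' b) =
      g z (coordFrame x z a) (coordFrame x z b) := by
    rintro z' rfl a b
    rfl
  refine (h _ ((extChartAt 𝓘(ℝ, E) x).left_inv (by simpa using hz)) _ _).trans ?_
  rw [coordFrame_coordComponents hz, coordFrame_coordComponents hz]

theorem chartEnd_extChartAt (J : EndField E N) {x z : N} (hz : z ∈ (chartAt E x).source)
    (v : TangentSpace 𝓘(ℝ, E) z) :
    chartEnd J x (extChartAt 𝓘(ℝ, E) x z) (coordComponents x z v) =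
      coordComponents x z (J z v) := by
  have h : ∀ z', z' = z → ∀ a : E, coordComponents x z' (J z' (coordFrame x z' a)) =
      coordComponents x z (J z (coordFrame x z a)) := by
    rintro z' rfl a
    rfl
  refine (h _ ((extChartAt 𝓘(ℝ, E) x).left_inv (by simpa using hz)) _).trans ?_
  rw [coordFrame_coordComponents hz]

variable (I) in
/-- The derivative at `u` of the inverse of the chart at `p`. -/
noncomputable def chartSymmDeriv (p : M) (u : E') :
    E' →L[ℝ] TangentSpace I ((extChartAt I p).symm u) :=
  mfderiv 𝓘(ℝ, E') I (extChartAt I p).symm u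

theorem mdifferentiableAt_extChartAt_symm {p : M} {u : E'} (hu : u ∈ (extChartAt I p).target) :
    MDifferentiableAt 𝓘(ℝ, E') I (extChartAt I p).symm u := by
  have : IsManifold I 1 M := IsManifold.of_le (n := ∞) (by norm_cast)
  have h := mdifferentiableWithinAt_extChartAt_symm hu
  rwa [I.range_eq_univ, mdifferentiableWithinAt_univ] at h

theorem chartSymmDeriv_injective {p : M} {u : E'} (hu : u ∈ (extChartAt I p).target) {v : E'}
    (hv : chartSymmDeriv I p u v = 0) : v = 0 := by
  have : IsManifold I 1 M := IsManifold.of_le (n := ∞) (by norm_cast)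
  have h := mfderiv_extChartAt_comp_mfderivWithin_extChartAt_symm hu
  rw [I.range_eq_univ, mfderivWithin_univ] at h
  have h2 := DFunLike.congr_fun h v
  refine Eq.trans h2.symm ?_
  exact (congrArg (mfderiv I 𝓘(ℝ, E') (extChartAt I p) ((extChartAt I p).symm u)) hv).trans
    (map_zero _)

theorem chartSymmDeriv_surjective {p : M} {u : E'} (hu : u ∈ (extChartAt I p).target)
    (w : TangentSpace I ((extChartAt I p).symm u)) : ∃ v, chartSymmDeriv I p u v = w := by
  have : IsManifold I 1 M := IsManifold.of_le (n := ∞) (by norm_cast)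
  have h := mfderivWithin_extChartAt_symm_comp_mfderiv_extChartAt hu
  rw [I.range_eq_univ, mfderivWithin_univ] at h
  exact ⟨_, DFunLike.congr_fun h w⟩

/-- The chain rule at points of the chart other than its centre. It lets hypotheses at every point
of `M` become identities near the centre, which can be differentiated. -/
theorem fderiv_writtenInExtChartAt_apply {φ : M → N} (hφ : ContMDiff I 𝓘(ℝ, E) ∞ φ) {p : M} {u : E'}
    (hu : u ∈ (extChartAt I p).target)
    (hφu : φ ((extChartAt I p).symm u) ∈ (chartAt E (φ p)).source) (a : E') :
    fderiv ℝ (writtenInExtChartAt I 𝓘(ℝ, E) p φ) u a =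
      coordComponents (φ p) (φ ((extChartAt I p).symm u))
        (mfderiv I 𝓘(ℝ, E) φ ((extChartAt I p).symm u) (chartSymmDeriv I p u a)) := by
  have : IsManifold 𝓘(ℝ, E) 1 N := IsManifold.of_le (n := ∞) (by norm_cast)
  have h₁ := (mdifferentiableAt_extChartAt_symm hu).hasMFDerivAt
  have h₂ := ((hφ ((extChartAt I p).symm u)).mdifferentiableAt (by simp)).hasMFDerivAt
  have h₃ := (mdifferentiableAt_extChartAt (I := 𝓘(ℝ, E)) hφu).hasMFDerivAt
  have h := (h₃.comp u (h₂.comp u h₁)).mfderiv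
  have h' : mfderiv 𝓘(ℝ, E') 𝓘(ℝ, E) (writtenInExtChartAt I 𝓘(ℝ, E) p φ) u =
      fderiv ℝ (writtenInExtChartAt I 𝓘(ℝ, E) p φ) u := mfderiv_eq_fderiv
  refine (DFunLike.congr_fun h' a).symm.trans ((DFunLike.congr_fun h a).trans ?_)
  have h₄ := TangentBundle.continuousLinearMapAt_trivializationAt (I := 𝓘(ℝ, E)) hφu
  exact (DFunLike.congr_fun h₄ _).symm

theorem eventually_mem_source {φ : M → N} (hφ : ContMDiff I 𝓘(ℝ, E) ∞ φ) (p : M) :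
    ∀ᶠ u in 𝓝 (extChartAt I p p), u ∈ (extChartAt I p).target ∧
      φ ((extChartAt I p).symm u) ∈ (chartAt E (φ p)).source := by
  refine Filter.Eventually.and (extChartAt_target_mem_nhds p) ?_
  have hc : ContinuousAt (fun u => φ ((extChartAt I p).symm u)) (extChartAt I p p) := by
    refine ContinuousAt.comp ?_ (continuousAt_extChartAt_symm p)
    exact hφ.continuous.continuousAt
  refine hc ((chartAt E (φ p)).open_source.mem_nhds ?_)
  simp only [extChartAt_to_inv]
  exact mem_chart_source E (φ p)

variable (A : HermitianStructure E N) {φ : M → N}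

theorem eventually_chartInduced_eq (hφ : ContMDiff I 𝓘(ℝ, E) ∞ φ) (p : M) :
    ∀ᶠ u in 𝓝 (extChartAt I p p), ∀ a b : E',
      chartInduced (I := I) A φ p u a b =
      inducedForm I A φ ((extChartAt I p).symm u)
        (chartSymmDeriv I p u a) (chartSymmDeriv I p u b) := by
  filter_upwards [eventually_mem_source hφ p] with u hu a b
  rw [chartInduced, fderiv_writtenInExtChartAt_apply hφ hu.1 hu.2,
    fderiv_writtenInExtChartAt_apply hφ hu.1 hu.2]
  exact chartMetric_extChartAt _ hu.2 _ _

theorem eventually_chartTwoForm_eq (hφ : ContMDiff I 𝓘(ℝ, E) ∞ φ) (p : M) :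
    ∀ᶠ u in 𝓝 (extChartAt I p p), ∀ a b : E',
      chartTwoForm (I := I) A φ p u a b = A.form (φ ((extChartAt I p).symm u))
        (A.J _ (mfderiv I 𝓘(ℝ, E) φ _ (chartSymmDeriv I p u a)))
        (mfderiv I 𝓘(ℝ, E) φ _ (chartSymmDeriv I p u b)) := by
  filter_upwards [eventually_mem_source hφ p] with u hu a b
  rw [chartTwoForm, fderiv_writtenInExtChartAt_apply hφ hu.1 hu.2,
    fderiv_writtenInExtChartAt_apply hφ hu.1 hu.2]
  have h := chartEnd_extChartAt A.J hu.2 (mfderiv I 𝓘(ℝ, E) φ _ (chartSymmDeriv I p u a))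
  refine Eq.trans ?_ (chartMetric_extChartAt (fun z => A.g.inner z) hu.2 _ _)
  exact congrArg (fun c : E => chartMetric (fun z => A.g.inner z) (φ p) _ c _) h

end Submanifold

/-! ### Product structure and invariance of the factors under `P` -/

/-- `P` commutes with `P²`, so it preserves the eigenspaces of `P²`; the two eigenvalues differ, so
the `D'`-component of `P u` vanishes. -/
theorem map_mem_of_sq_eq {V : Type*} [AddCommGroup V] [Module ℝ V] {D D' : Submodule ℝ V}
    (hsup : D ⊔ D' = ⊤) (P : V →ₗ[ℝ] V) {q q' : ℝ}
    (hq : q ≠ q') (hP : ∀ u ∈ D, P (P u) = -q • u) (hP' : ∀ u ∈ D', P (P u) = -q' • u) :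
    ∀ u ∈ D, P u ∈ D := by
  intro u hu
  obtain ⟨v, hv, w, hw, hvw⟩ := Submodule.mem_sup.1 (hsup ▸ Submodule.mem_top : P u ∈ D ⊔ D')
  have h₁ : P (P (P u)) = -q • P u := by rw [hP u hu, map_smul]
  rw [← hvw, map_add, map_add, hP v hv, hP' w hw, smul_add] at h₁
  have h₂ : (q - q') • w = 0 := by
    have := add_left_cancel h₁
    rw [neg_smul, neg_smul, neg_inj] at this
    rw [sub_smul, this, sub_self]
  rcases smul_eq_zero.1 h₂ with h | h
  · exact absurd (sub_eq_zero.1 h) hq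
  · rw [← hvw, h, add_zero]
    exact hv

section Warped

variable {E : Type*} [NormedAddCommGroup E] [NormedSpace ℝ E] [FiniteDimensional ℝ E]
  {N : Type*} [TopologicalSpace N] [ChartedSpace E N] [IsManifold 𝓘(ℝ, E) ∞ N]
  {E₁ : Type*} [NormedAddCommGroup E₁] [NormedSpace ℝ E₁] [FiniteDimensional ℝ E₁]
  {M₁ : Type*} [TopologicalSpace M₁] [ChartedSpace E₁ M₁] [IsManifold 𝓘(ℝ, E₁) ∞ M₁]
  {E₂ : Type*} [NormedAddCommGroup E₂] [NormedSpace ℝ E₂] [FiniteDimensional ℝ E₂]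
  {M₂ : Type*} [TopologicalSpace M₂] [ChartedSpace E₂ M₂] [IsManifold 𝓘(ℝ, E₂) ∞ M₂]

theorem mem_D₁ {p : M₁ × M₂} {u : E₁ × E₂} : u ∈ D₁ E₁ M₁ E₂ M₂ p ↔ u.2 = 0 := by
  unfold D₁
  rw [mfderiv_snd]
  exact Iff.rfl

theorem mem_D₂ {p : M₁ × M₂} {u : E₁ × E₂} : u ∈ D₂ E₁ M₁ E₂ M₂ p ↔ u.1 = 0 := by
  unfold D₂
  rw [mfderiv_fst]
  exact Iff.rfl

theorem D₁_sup_D₂ (p : M₁ × M₂) : D₁ E₁ M₁ E₂ M₂ p ⊔ D₂ E₁ M₁ E₂ M₂ p = ⊤ := by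
  rw [eq_top_iff]
  rintro (u : E₁ × E₂) -
  refine Submodule.mem_sup.2 ⟨((u.1, 0) : E₁ × E₂), mem_D₁.2 rfl, ((0, u.2) : E₁ × E₂),
    mem_D₂.2 rfl, ?_⟩
  exact (Prod.ext (add_zero _) (zero_add _) : ((u.1, 0) : E₁ × E₂) + (0, u.2) = u)

theorem finrank_D₁ (p : M₁ × M₂) : finrank ℝ (D₁ E₁ M₁ E₂ M₂ p) = finrank ℝ E₁ := by
  unfold D₁
  rw [mfderiv_snd]
  have e : E₁ ≃ₗ[ℝ] (LinearMap.snd ℝ E₁ E₂).ker :=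
    (LinearEquiv.ofInjective (LinearMap.inl ℝ E₁ E₂) LinearMap.inl_injective).trans
      (LinearEquiv.ofEq _ _ (LinearMap.range_inl ℝ E₁ E₂))
  exact e.symm.finrank_eq

theorem finrank_D₂ (p : M₁ × M₂) : finrank ℝ (D₂ E₁ M₁ E₂ M₂ p) = finrank ℝ E₂ := by
  unfold D₂
  rw [mfderiv_fst]
  have e : E₂ ≃ₗ[ℝ] (LinearMap.fst ℝ E₁ E₂).ker :=
    (LinearEquiv.ofInjective (LinearMap.inr ℝ E₁ E₂) LinearMap.inr_injective).trans
      (LinearEquiv.ofEq _ _ (LinearMap.range_inr ℝ E₁ E₂))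
  exact e.symm.finrank_eq

theorem warpedMetric_apply
    (g₁ : Bundle.ContMDiffRiemannianMetric 𝓘(ℝ, E₁) ∞ E₁ (TangentSpace 𝓘(ℝ, E₁) : M₁ → Type _))
    (g₂ : Bundle.ContMDiffRiemannianMetric 𝓘(ℝ, E₂) ∞ E₂ (TangentSpace 𝓘(ℝ, E₂) : M₂ → Type _))
    (lam : M₁ → ℝ) (p : M₁ × M₂) (u v : E₁ × E₂) :
    warpedMetric g₁ g₂ lam p u v =
      g₁.inner p.1 u.1 v.1 + lam p.1 ^ 2 * g₂.inner p.2 u.2 v.2 := by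
  unfold warpedMetric
  rw [mfderiv_fst, mfderiv_snd]
  rfl

theorem extChartAt_prod_symm_apply (p : M₁ × M₂) (u : E₁ × E₂) :
    (extChartAt (𝓘(ℝ, E₁).prod 𝓘(ℝ, E₂)) p).symm u =
      ((extChartAt 𝓘(ℝ, E₁) p.1).symm u.1, (extChartAt 𝓘(ℝ, E₂) p.2).symm u.2) := by
  rw [extChartAt_prod]
  rfl

theorem mem_target_prod {p : M₁ × M₂} {u : E₁ × E₂}
    (hu : u ∈ (extChartAt (𝓘(ℝ, E₁).prod 𝓘(ℝ, E₂)) p).target) :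
    u.1 ∈ (extChartAt 𝓘(ℝ, E₁) p.1).target ∧ u.2 ∈ (extChartAt 𝓘(ℝ, E₂) p.2).target := by
  rw [extChartAt_prod] at hu
  exact hu

/-- The chart of the product is the product chart; composing with each projection and using
uniqueness of the derivative gives the components. -/
theorem chartSymmDeriv_prod {p : M₁ × M₂} {u : E₁ × E₂}
    (hu : u ∈ (extChartAt (𝓘(ℝ, E₁).prod 𝓘(ℝ, E₂)) p).target) (a : E₁ × E₂) :
    (chartSymmDeriv (𝓘(ℝ, E₁).prod 𝓘(ℝ, E₂)) p u a : E₁ × E₂) =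
      ((chartSymmDeriv 𝓘(ℝ, E₁) p.1 u.1 a.1 : E₁), (chartSymmDeriv 𝓘(ℝ, E₂) p.2 u.2 a.2 : E₂)) := by
  have h := (mdifferentiableAt_extChartAt_symm hu).hasMFDerivAt
  have h₁ := (mdifferentiableAt_extChartAt_symm (mem_target_prod hu).1).hasMFDerivAt
  have h₂ := (mdifferentiableAt_extChartAt_symm (mem_target_prod hu).2).hasMFDerivAt
  have f₁ : HasMFDerivAt 𝓘(ℝ, E₁ × E₂) 𝓘(ℝ, E₁) Prod.fst u (ContinuousLinearMap.fst ℝ E₁ E₂) :=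
    hasFDerivAt_fst.hasMFDerivAt
  have f₂ : HasMFDerivAt 𝓘(ℝ, E₁ × E₂) 𝓘(ℝ, E₂) Prod.snd u (ContinuousLinearMap.snd ℝ E₁ E₂) :=
    hasFDerivAt_snd.hasMFDerivAt
  have e₁ : Prod.fst ∘ (extChartAt (𝓘(ℝ, E₁).prod 𝓘(ℝ, E₂)) p).symm =
      (extChartAt 𝓘(ℝ, E₁) p.1).symm ∘ Prod.fst :=
    funext fun u => congrArg Prod.fst (extChartAt_prod_symm_apply p u)
  have e₂ : Prod.snd ∘ (extChartAt (𝓘(ℝ, E₁).prod 𝓘(ℝ, E₂)) p).symm =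
      (extChartAt 𝓘(ℝ, E₂) p.2).symm ∘ Prod.snd :=
    funext fun u => congrArg Prod.snd (extChartAt_prod_symm_apply p u)
  have k₁ := ((hasMFDerivAt_fst (I := 𝓘(ℝ, E₁)) (I' := 𝓘(ℝ, E₂)) _).comp u h).mfderiv
  have k₂ := ((hasMFDerivAt_snd (I := 𝓘(ℝ, E₁)) (I' := 𝓘(ℝ, E₂)) _).comp u h).mfderiv
  have l₁ := (h₁.comp u f₁).mfderiv
  have l₂ := (h₂.comp u f₂).mfderiv
  rw [e₁] at k₁
  rw [e₂] at k₂
  exact Prod.ext (DFunLike.congr_fun (k₁.symm.trans l₁) a) (DFunLike.congr_fun (k₂.symm.trans l₂) a)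

variable {A : HermitianStructure E N}
  {g₁ : Bundle.ContMDiffRiemannianMetric 𝓘(ℝ, E₁) ∞ E₁ (TangentSpace 𝓘(ℝ, E₁) : M₁ → Type _)}
  {g₂ : Bundle.ContMDiffRiemannianMetric 𝓘(ℝ, E₂) ∞ E₂ (TangentSpace 𝓘(ℝ, E₂) : M₂ → Type _)}
  {lam : M₁ → ℝ} {φ : M₁ × M₂ → N} {θ₁ : M₁ → ℝ} {θ₂ : M₂ → ℝ}

theorem IsWarpedProductImmersion.inducedForm_apply (hφ : IsWarpedProductImmersion A g₁ g₂ lam φ)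
    (p : M₁ × M₂) (u v : E₁ × E₂) : inducedForm (𝓘(ℝ, E₁).prod 𝓘(ℝ, E₂)) A φ p u v =
      g₁.inner p.1 u.1 v.1 + lam p.1 ^ 2 * g₂.inner p.2 u.2 v.2 :=
  (hφ.isometric p u v).trans (warpedMetric_apply g₁ g₂ lam p u v)

theorem IsWarpedProductImmersion.isInnerProduct (hφ : IsWarpedProductImmersion A g₁ g₂ lam φ)
    (p : M₁ × M₂) : IsInnerProduct (inducedForm (𝓘(ℝ, E₁).prod 𝓘(ℝ, E₂)) A φ p) := by
  refine ⟨fun u v => A.g.symm _ _ _, fun (v : E₁ × E₂) hv => ?_⟩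
  refine lt_of_lt_of_eq ?_ (hφ.inducedForm_apply p v v).symm
  have hl := pow_pos (hφ.lam_pos p.1) 2
  have e₁ : 0 ≤ g₁.inner p.1 v.1 v.1 := by
    by_cases h : v.1 = 0
    · exact (((congrArg (g₁.inner p.1 v.1) h).trans (map_zero _))).ge
    · exact (g₁.pos p.1 v.1 h).le
  by_cases h₂ : v.2 = 0
  · have h₁ : v.1 ≠ 0 := fun h₁ => hv (Prod.ext h₁ h₂ : v = 0)
    have e₂ : g₂.inner p.2 v.2 v.2 = 0 := (congrArg (g₂.inner p.2 v.2) h₂).trans (map_zero _)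
    rw [e₂, mul_zero, add_zero]
    exact g₁.pos p.1 v.1 h₁
  · exact add_pos_of_nonneg_of_pos e₁ (mul_pos hl (g₂.pos p.2 v.2 h₂))

theorem IsWarpedProductImmersion.orthogonal (hφ : IsWarpedProductImmersion A g₁ g₂ lam φ)
    (p : M₁ × M₂) : ∀ u ∈ D₁ E₁ M₁ E₂ M₂ p, ∀ v ∈ D₂ E₁ M₁ E₂ M₂ p,
      inducedForm (𝓘(ℝ, E₁).prod 𝓘(ℝ, E₂)) A φ p u v = 0 := by
  intro (u : E₁ × E₂) hu (v : E₁ × E₂) hv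
  refine (hφ.inducedForm_apply p u v).trans ?_
  have h₁ : v.1 = 0 := (mem_D₂ (E₁ := E₁) (E₂ := E₂)).1 hv
  have h₂ : u.2 = 0 := (mem_D₁ (E₁ := E₁) (E₂ := E₂)).1 hu
  have e₁ : g₁.inner p.1 u.1 v.1 = 0 :=
    (congrArg (g₁.inner p.1 u.1) h₁).trans (map_zero _)
  have e₂ : g₂.inner p.2 u.2 v.2 = 0 :=
    (g₂.symm p.2 u.2 v.2).trans ((congrArg (g₂.inner p.2 v.2) h₂).trans (map_zero _))
  rw [e₁, e₂]
  simp

theorem IsPointwiseBiSlant.cos_θ₁_pos (hθ : IsPointwiseBiSlant (E₁ := E₁) (E₂ := E₂) A φ θ₁ θ₂)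
    (x : M₁) : 0 < Real.cos (θ₁ x) :=
  Real.cos_pos_of_mem_Ioo ⟨by linarith [(hθ.θ₁_mem x).1, Real.pi_pos], (hθ.θ₁_mem x).2⟩

theorem IsPointwiseBiSlant.cos_θ₂_pos (hθ : IsPointwiseBiSlant (E₁ := E₁) (E₂ := E₂) A φ θ₁ θ₂)
    (y : M₂) : 0 < Real.cos (θ₂ y) :=
  Real.cos_pos_of_mem_Ioo ⟨by linarith [(hθ.θ₂_mem y).1, Real.pi_pos], (hθ.θ₂_mem y).2⟩

theorem IsPointwiseBiSlant.cos_sq_ne (hθ : IsPointwiseBiSlant (E₁ := E₁) (E₂ := E₂) A φ θ₁ θ₂)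
    (p : M₁ × M₂) : Real.cos (θ₁ p.1) ^ 2 ≠ Real.cos (θ₂ p.2) ^ 2 := by
  have h₁ := hθ.θ₁_mem p.1
  have h₂ := hθ.θ₂_mem p.2
  intro h
  refine hθ.ne p.1 p.2 (Real.injOn_cos ⟨h₁.1.le, by linarith [h₁.2, Real.pi_pos]⟩
    ⟨h₂.1.le, by linarith [h₂.2, Real.pi_pos]⟩ ?_)
  exact (sq_eq_sq₀ (hθ.cos_θ₁_pos p.1).le (hθ.cos_θ₂_pos p.2).le).1 h

theorem P_mem_D₁ (hφ : IsWarpedProductImmersion A g₁ g₂ lam φ)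
    (hθ : IsPointwiseBiSlant (E₁ := E₁) (E₂ := E₂) A φ θ₁ θ₂) (p : M₁ × M₂) :
    ∀ u ∈ D₁ E₁ M₁ E₂ M₂ p, P (𝓘(ℝ, E₁).prod 𝓘(ℝ, E₂)) A φ p u ∈ D₁ E₁ M₁ E₂ M₂ p :=
  map_mem_of_sq_eq (D₁_sup_D₂ p) (Pₗ A (hφ.isInnerProduct p)) (hθ.cos_sq_ne p) (hθ.slant₁ p)
    (hθ.slant₂ p)

theorem P_mem_D₂ (hφ : IsWarpedProductImmersion A g₁ g₂ lam φ)
    (hθ : IsPointwiseBiSlant (E₁ := E₁) (E₂ := E₂) A φ θ₁ θ₂) (p : M₁ × M₂) :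
    ∀ u ∈ D₂ E₁ M₁ E₂ M₂ p, P (𝓘(ℝ, E₁).prod 𝓘(ℝ, E₂)) A φ p u ∈ D₂ E₁ M₁ E₂ M₂ p :=
  map_mem_of_sq_eq ((sup_comm _ _).trans (D₁_sup_D₂ p)) (Pₗ A (hφ.isInnerProduct p))
    (hθ.cos_sq_ne p).symm (hθ.slant₂ p) (hθ.slant₁ p)

end Warped

/-! ### The Codazzi-type identity on a submanifold -/

section Submanifold

variable {E : Type*} [NormedAddCommGroup E] [NormedSpace ℝ E] [FiniteDimensional ℝ E]
  {N : Type*} [TopologicalSpace N] [ChartedSpace E N] [IsManifold 𝓘(ℝ, E) ∞ N]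
  {E' H : Type*} [NormedAddCommGroup E'] [NormedSpace ℝ E'] [FiniteDimensional ℝ E']
  [TopologicalSpace H] {I : ModelWithCorners ℝ E' H} [I.Boundaryless]
  {M : Type*} [TopologicalSpace M] [ChartedSpace H M] [IsManifold I ∞ M]
  {A : HermitianStructure E N} {φ : M → N} {p : M}

theorem inducedForm_P (hp : IsInnerProduct (inducedForm I A φ p)) (u v : TangentSpace I p) :
    inducedForm I A φ p (P I A φ p u) v =
      A.form (φ p) (A.J (φ p) (mfderiv I 𝓘(ℝ, E) φ p u)) (mfderiv I 𝓘(ℝ, E) φ p v) :=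
  form_tangentPart A hp _ v

theorem inducedForm_P_skew (hp : IsInnerProduct (inducedForm I A φ p)) (u v : TangentSpace I p) :
    inducedForm I A φ p u (P I A φ p v) = - inducedForm I A φ p (P I A φ p u) v := by
  rw [hp.1 u, inducedForm_P hp, inducedForm_P hp, A.form_J, (A.isInnerProduct_form (φ p)).1]

theorem J_eq_F_add_P (u : TangentSpace I p) :
    A.J (φ p) (mfderiv I 𝓘(ℝ, E) φ p u) =
      F I A φ p u + mfderiv I 𝓘(ℝ, E) φ p (P I A φ p u) :=
  (sub_add_cancel _ _).symm

/-- `J` is an isometry and `J u = F u + P u` is an orthogonal splitting. With `inducedForm_P_P` this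
makes `F` a homothety with factor `sin θ` on each slant factor. -/
theorem form_F_F (hp : IsInnerProduct (inducedForm I A φ p)) (u v : TangentSpace I p) :
    A.form (φ p) (F I A φ p u) (F I A φ p v) =
      inducedForm I A φ p u v - inducedForm I A φ p (P I A φ p u) (P I A φ p v) := by
  have h : A.form (φ p) (A.J (φ p) (mfderiv I 𝓘(ℝ, E) φ p u))
      (A.J (φ p) (mfderiv I 𝓘(ℝ, E) φ p v)) = inducedForm I A φ p u v := A.compatible _ _ _
  have h₁ : A.form (φ p) (F I A φ p u) (mfderiv I 𝓘(ℝ, E) φ p (P I A φ p v)) = 0 :=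
    form_normalPart A hp _ _
  have h₂ : A.form (φ p) (mfderiv I 𝓘(ℝ, E) φ p (P I A φ p u)) (F I A φ p v) = 0 :=
    ((A.isInnerProduct_form (φ p)).1 _ _).trans (form_normalPart A hp _ _)
  have h₃ : A.form (φ p) (mfderiv I 𝓘(ℝ, E) φ p (P I A φ p u))
    (mfderiv I 𝓘(ℝ, E) φ p (P I A φ p v)) =
      inducedForm I A φ p (P I A φ p u) (P I A φ p v) := rfl
  rw [J_eq_F_add_P u, J_eq_F_add_P v, map_add, map_add, LinearMap.add_apply, LinearMap.add_apply,
    h₁, h₂, h₃] at h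
  linarith

theorem inducedForm_P_P (hp : IsInnerProduct (inducedForm I A φ p)) {q : ℝ}
    {u : TangentSpace I p} (hu : P I A φ p (P I A φ p u) = -q • u) (v : TangentSpace I p) :
    inducedForm I A φ p (P I A φ p u) (P I A φ p v) = q * inducedForm I A φ p u v := by
  rw [inducedForm_P_skew hp, hu, map_smul, LinearMap.smul_apply, smul_eq_mul]
  ring

theorem chartInduced_extChartAt (hφ : ContMDiff I 𝓘(ℝ, E) ∞ φ) (a b : E') :
    chartInduced (I := I) A φ p (extChartAt I p p) a b = inducedForm I A φ p a b := by
  dsimp only [chartInduced]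
  rw [writtenInExtChartAt_self, chartMetric_self, fderiv_writtenInExtChartAt hφ]
  rfl

/-- The witness `s` is the coordinate vector of `P x`, computed at the nearby point `u` rather than
at `p`. -/
theorem exists_chartTwoForm_eq {u : E'} (hu : u ∈ (extChartAt I p).target)
    (hm : ∀ a b : E', chartInduced (I := I) A φ p u a b =
      inducedForm I A φ ((extChartAt I p).symm u)
      (chartSymmDeriv I p u a) (chartSymmDeriv I p u b))
    (hΩ : ∀ a b : E', chartTwoForm (I := I) A φ p u a b = A.form (φ ((extChartAt I p).symm u))
      (A.J _ (mfderiv I 𝓘(ℝ, E) φ _ (chartSymmDeriv I p u a)))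
      (mfderiv I 𝓘(ℝ, E) φ _ (chartSymmDeriv I p u b)))
    (hz : IsInnerProduct (inducedForm I A φ ((extChartAt I p).symm u)))
    {K : Submodule ℝ (TangentSpace I p)}
    {K₁ : Submodule ℝ (TangentSpace I ((extChartAt I p).symm u))}
    (hK : ∀ a : E', chartSymmDeriv I p u a ∈ K₁ ↔ a ∈ K)
    (hPK : ∀ w ∈ K₁, P I A φ _ w ∈ K₁) {x : E'} (hx : x ∈ K) :
    ∃ s : E', s ∈ K ∧ (∀ y, chartTwoForm (I := I) A φ p u x y = chartInduced (I := I) A φ p u s y) ∧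
      ∀ q : ℝ, (∀ w ∈ K₁, P I A φ _ (P I A φ _ w) = -q • w) →
        chartInduced (I := I) A φ p u s s = q * chartInduced (I := I) A φ p u x x := by
  obtain ⟨s, hs⟩ := chartSymmDeriv_surjective hu (P I A φ _ (chartSymmDeriv I p u x))
  refine ⟨s, (hK s).1 (hs ▸ hPK _ ((hK x).2 hx)), fun y => ?_, fun q hq => ?_⟩
  · rw [hΩ, hm, hs, inducedForm_P hz]
  · rw [hm, hm, hs, inducedForm_P_P hz (hq _ ((hK x).2 hx))]

/-- The Codazzi-type identity for a pair of complementary `P`-invariant distributions which are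
orthogonal near `p`, where the metric of the first one is scaled, and its slant angle is constant,
along the second one. -/
theorem codazzi {lee : ∀ x : N, TangentSpace 𝓘(ℝ, E) x →L[ℝ] ℝ}
    (hA : IsLCK A lee) (hφ : ContMDiff I 𝓘(ℝ, E) ∞ φ) (hp : IsInnerProduct (inducedForm I A φ p))
    {K K' : Submodule ℝ (TangentSpace I p)}
    (horth : ∀ x ∈ K, ∀ z ∈ K', inducedForm I A φ p x z = 0)
    (hPK : ∀ x ∈ K, P I A φ p x ∈ K) (hPK' : ∀ z ∈ K', P I A φ p z ∈ K')
    (hm : ∀ᶠ u in 𝓝 (extChartAt I p p), ∀ x ∈ K, ∀ z ∈ K', chartInduced (I := I) A φ p u x z = 0)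
    (hΩ : ∀ᶠ u in 𝓝 (extChartAt I p p), ∀ x ∈ K, ∀ z ∈ K', chartTwoForm (I := I) A φ p u x z = 0)
    {q : ℝ} (hq : q ≠ 0) (hPP : ∀ x ∈ K, P I A φ p (P I A φ p x) = -q • x)
    {κ : TangentSpace I p → ℝ}
    (hρ : ∀ z : E', z ∈ K' → ∃ ρ : ℝ → ℝ, HasDerivAt ρ (2 * κ z) 0 ∧ ρ 0 = 1 ∧
      ∀ᶠ t in 𝓝 (0 : ℝ), ∀ x ∈ K,
        (∀ y ∈ K, chartInduced (I := I) A φ p (extChartAt I p p + t • z) x y =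
        ρ t * inducedForm I A φ p x y) ∧
        ∃ s ∈ K, (∀ y ∈ K, chartTwoForm (I := I) A φ p (extChartAt I p p + t • z) x y =
          chartInduced (I := I) A φ p (extChartAt I p p + t • z) s y) ∧
          chartInduced (I := I) A φ p (extChartAt I p p + t • z) s s =
            q * chartInduced (I := I) A φ p (extChartAt I p p + t • z) x x) :
    ∀ x ∈ K, ∀ y ∈ K, ∀ z ∈ K',
      A.form (φ p) (sff I A φ p x y) (F I A φ p z) +
        1 / 2 * inducedForm I A φ p x y * A.form (φ p) (leeField A lee (φ p)) (F I A φ p z) =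
      A.form (φ p) (sff I A φ p x z) (F I A φ p y) := by
  have hγ := A.isInnerProduct_form (φ p)
  choose dm hdm hdmv using hasFDerivAt_chartInduced (I := I) A hφ p
  choose dΩ hdΩ hdΩv using hasFDerivAt_chartTwoForm (I := I) A hA hφ p
  have hline : ∀ z : E', HasDerivAt (fun t : ℝ => extChartAt I p p + t • z) z 0 := fun z => by
    simpa using ((hasDerivAt_id (0 : ℝ)).smul_const z).const_add (extChartAt I p p)
  have hdmt : ∀ z a b : E', HasDerivAt
      (fun t : ℝ => chartInduced (I := I) A φ p (extChartAt I p p + t • z) a b) (dm a b z) 0 :=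
    fun z a b => HasFDerivAt.comp_hasDerivAt_of_eq 0 (hdm a b) (hline z) (by simp)
  have hdΩt : ∀ z a b : E', HasDerivAt
      (fun t : ℝ => chartTwoForm (I := I) A φ p (extChartAt I p p + t • z) a b) (dΩ a b z) 0 :=
    fun z a b => HasFDerivAt.comp_hasDerivAt_of_eq 0 (hdΩ a b) (hline z) (by simp)
  have hΩ₀ : ∀ a b : E', chartTwoForm (I := I) A φ p (extChartAt I p p) a b =
      inducedForm I A φ p (P I A φ p a) b := by
    intro a b
    refine Eq.trans ?_ (inducedForm_P hp a b).symm
    dsimp only [chartTwoForm]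
    rw [writtenInExtChartAt_self, chartMetric_self, chartEnd_self, fderiv_writtenInExtChartAt hφ]
    rfl
  have key := codazzi_of_derivatives hp hγ (mfderiv I 𝓘(ℝ, E) φ p).toLinearMap
    (A.J (φ p)).toLinearMap (A.form_J (φ p)) (fun _ _ => rfl) (c := covDeriv I A φ p)
    (h := sff I A φ p) (τ := fun u v => tangentPart I A φ p (covDeriv I A φ p u v))
    (F := F I A φ p) (P := P I A φ p) (covDeriv_comm A hφ p)
    (fun u v => by unfold sff; rw [covDeriv_comm A hφ]) (fun u v => (sub_add_cancel _ _).symm)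
    J_eq_F_add_P (fun u v => (hγ.1 _ _).trans (form_normalPart A hp _ _)) (lee (φ p)).toLinearMap
    (dm := fun u v w => dm v w u) (dΩ := fun u v w => dΩ v w u)
    (fun u v w => hdmv v w u) (fun u v w => hdΩv v w u) horth hPK hPK' (κ := κ) ?_ ?_ ?_ hq
    (fun x hx => inducedForm_P_P hp (hPP x hx) x) ?_
  · intro x hx y hy z hz
    have h := key x hx y hy z hz
    have hB : A.form (φ p) (leeField A lee (φ p)) (F I A φ p z) = lee (φ p) (F I A φ p z) :=
      riesz_apply hγ _ _
    rw [hB]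
    exact h
  · intro x hx y hy z hz
    have h : (fun u => chartInduced (I := I) A φ p u y z) =ᶠ[𝓝 (extChartAt I p p)] fun _ => 0 :=
      hm.mono fun u hu => hu y hy z hz
    exact DFunLike.congr_fun ((hdm y z).unique
      ((hasFDerivAt_const (0 : ℝ) _).congr_of_eventuallyEq h)) x
  · intro x hx y hy (z : E') hz
    obtain ⟨ρ, hρ₁, -, hρ₂⟩ := hρ z hz
    have h : (fun t : ℝ => chartInduced (I := I) A φ p (extChartAt I p p + t • z) x y) =ᶠ[𝓝 0]
      fun t => ρ t * inducedForm I A φ p x y := hρ₂.mono fun t ht => (ht x hx).1 y hy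
    exact (hdmt z x y).unique ((hρ₁.mul_const _).congr_of_eventuallyEq h)
  · intro x hx y hy z hz
    have h : (fun u => chartTwoForm (I := I) A φ p u y z) =ᶠ[𝓝 (extChartAt I p p)] fun _ => 0 :=
      hΩ.mono fun u hu => hu y hy z hz
    exact DFunLike.congr_fun ((hdΩ y z).unique
      ((hasFDerivAt_const (0 : ℝ) _).congr_of_eventuallyEq h)) x
  · intro x hx (z : E') hz
    obtain ⟨ρ, hρ₁, hρ₀, hρ₂⟩ := hρ z hz
    have hfr := frame_isFrame hp K
    set e := frame (inducedForm I A φ p) K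
    -- The frame stays frozen at `p`. At time `t` the metric on `K` is `ρ t` times that at `p`, so
    -- the sum is `ρ² β(s,s)`, and the slant condition replaces `ρ β(s,s)` by `q ρ β(x,x)`. Its
    -- derivative at `0`, halved, is the sum required, since `ρ 0 = 1` and `ρ' 0 = 2κ`.
    have h : (fun t : ℝ => ∑ k, chartTwoForm (I := I) A φ p (extChartAt I p p + t • z) x (e k) ^ 2)
        =ᶠ[𝓝 0] fun t => ρ t ^ 2 * (q * inducedForm I A φ p x x) := by
      filter_upwards [hρ₂] with t ht
      obtain ⟨s, hs, hs₁, hs₂⟩ := (ht x hx).2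
      rw [(ht s hs).1 s hs, (ht x hx).1 x hx, hfr.parseval hp hs s, Finset.mul_sum] at hs₂
      have : ∀ k, chartTwoForm (I := I) A φ p (extChartAt I p p + t • z) x (e k) ^ 2 =
          ρ t * (ρ t * (inducedForm I A φ p s (e k) * inducedForm I A φ p s (e k))) := by
        intro k
        rw [hs₁ _ (hfr.mem k), (ht s hs).1 _ (hfr.mem k)]
        ring
      simp only [this, ← Finset.mul_sum] at hs₂ ⊢
      rw [hs₂]
      ring
    have d₁ := HasDerivAt.fun_sum (u := Finset.univ) fun k _ => (hdΩt z x (e k)).pow 2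
    have d₂ := ((hρ₁.pow 2).mul_const (q * inducedForm I A φ p x x)).congr_of_eventuallyEq h
    have h₃ := d₁.unique d₂
    rw [hρ₀] at h₃
    have h₄ : ∀ k, inducedForm I A φ p (P I A φ p x) (e k) * dΩ x (e k) z =
        1 / 2 * (((2 : ℕ) : ℝ) * chartTwoForm (I := I) A φ p (extChartAt I p p + (0 : ℝ) • z) x
          (e k) ^ (2 - 1) * dΩ x (e k) z) := by
      intro k
      have h₅ : chartTwoForm (I := I) A φ p (extChartAt I p p + (0 : ℝ) • z) x (e k) =
          inducedForm I A φ p (P I A φ p x) (e k) := by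
        refine Eq.trans ?_ (hΩ₀ x (e k))
        rw [zero_smul, add_zero]
      rw [h₅]
      norm_num
      ring
    refine (Finset.sum_congr rfl fun k _ => h₄ k).trans ?_
    rw [← Finset.mul_sum, h₃]
    norm_num
    ring

end Submanifold

/-! ### The identity for the two factors of the warped product -/

section Warped

variable {E : Type*} [NormedAddCommGroup E] [NormedSpace ℝ E] [FiniteDimensional ℝ E]
  {N : Type*} [TopologicalSpace N] [ChartedSpace E N] [IsManifold 𝓘(ℝ, E) ∞ N]
  {E₁ : Type*} [NormedAddCommGroup E₁] [NormedSpace ℝ E₁] [FiniteDimensional ℝ E₁]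
  {M₁ : Type*} [TopologicalSpace M₁] [ChartedSpace E₁ M₁] [IsManifold 𝓘(ℝ, E₁) ∞ M₁]
  {E₂ : Type*} [NormedAddCommGroup E₂] [NormedSpace ℝ E₂] [FiniteDimensional ℝ E₂]
  {M₂ : Type*} [TopologicalSpace M₂] [ChartedSpace E₂ M₂] [IsManifold 𝓘(ℝ, E₂) ∞ M₂]

theorem chartSymmDeriv_mem_D₁ {p : M₁ × M₂} {u : E₁ × E₂}
    (hu : u ∈ (extChartAt (𝓘(ℝ, E₁).prod 𝓘(ℝ, E₂)) p).target) (a : E₁ × E₂) :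
    chartSymmDeriv (𝓘(ℝ, E₁).prod 𝓘(ℝ, E₂)) p u a ∈ D₁ E₁ M₁ E₂ M₂ _ ↔ a ∈ D₁ E₁ M₁ E₂ M₂ p := by
  refine (mem_D₁ (E₁ := E₁) (E₂ := E₂)).trans (Iff.trans ?_ (mem_D₁ (E₁ := E₁) (E₂ := E₂)).symm)
  have h := congrArg Prod.snd (chartSymmDeriv_prod hu a)
  refine ⟨fun h₀ => chartSymmDeriv_injective (mem_target_prod hu).2 (h.symm.trans h₀), fun h₀ => ?_⟩
  refine h.trans ((congrArg (chartSymmDeriv 𝓘(ℝ, E₂) p.2 u.2) h₀).trans (map_zero _))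

theorem chartSymmDeriv_mem_D₂ {p : M₁ × M₂} {u : E₁ × E₂}
    (hu : u ∈ (extChartAt (𝓘(ℝ, E₁).prod 𝓘(ℝ, E₂)) p).target) (a : E₁ × E₂) :
    chartSymmDeriv (𝓘(ℝ, E₁).prod 𝓘(ℝ, E₂)) p u a ∈ D₂ E₁ M₁ E₂ M₂ _ ↔ a ∈ D₂ E₁ M₁ E₂ M₂ p := by
  refine (mem_D₂ (E₁ := E₁) (E₂ := E₂)).trans (Iff.trans ?_ (mem_D₂ (E₁ := E₁) (E₂ := E₂)).symm)
  have h := congrArg Prod.fst (chartSymmDeriv_prod hu a)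
  refine ⟨fun h₀ => chartSymmDeriv_injective (mem_target_prod hu).1 (h.symm.trans h₀), fun h₀ => ?_⟩
  refine h.trans ((congrArg (chartSymmDeriv 𝓘(ℝ, E₁) p.1 u.1) h₀).trans (map_zero _))

variable {A : HermitianStructure E N}
  {g₁ : Bundle.ContMDiffRiemannianMetric 𝓘(ℝ, E₁) ∞ E₁ (TangentSpace 𝓘(ℝ, E₁) : M₁ → Type _)}
  {g₂ : Bundle.ContMDiffRiemannianMetric 𝓘(ℝ, E₂) ∞ E₂ (TangentSpace 𝓘(ℝ, E₂) : M₂ → Type _)}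
  {lam : M₁ → ℝ} {φ : M₁ × M₂ → N} {θ₁ : M₁ → ℝ} {θ₂ : M₂ → ℝ}

/-- The metric in the chart is a warped product. -/
theorem IsWarpedProductImmersion.eventually_chartInduced_eq
    (hφ : IsWarpedProductImmersion A g₁ g₂ lam φ) (p : M₁ × M₂) :
    ∃ (G₁ : E₁ → E₁ → E₁ → ℝ) (G₂ : E₂ → E₂ → E₂ → ℝ),
      (∀ v a, G₁ v 0 a = 0 ∧ G₁ v a 0 = 0) ∧ (∀ v a, G₂ v 0 a = 0 ∧ G₂ v a 0 = 0) ∧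
      ∀ᶠ u in 𝓝 (extChartAt (𝓘(ℝ, E₁).prod 𝓘(ℝ, E₂)) p p), ∀ a b : E₁ × E₂,
        chartInduced (I := 𝓘(ℝ, E₁).prod 𝓘(ℝ, E₂)) A φ p u a b =
          G₁ u.1 a.1 b.1 + lam ((extChartAt 𝓘(ℝ, E₁) p.1).symm u.1) ^ 2 * G₂ u.2 a.2 b.2 := by
  refine ⟨fun v a b => g₁.inner ((extChartAt 𝓘(ℝ, E₁) p.1).symm v)
    (chartSymmDeriv 𝓘(ℝ, E₁) p.1 v a) (chartSymmDeriv 𝓘(ℝ, E₁) p.1 v b),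
    fun v a b => g₂.inner ((extChartAt 𝓘(ℝ, E₂) p.2).symm v)
    (chartSymmDeriv 𝓘(ℝ, E₂) p.2 v a) (chartSymmDeriv 𝓘(ℝ, E₂) p.2 v b), ?_, ?_, ?_⟩
  · intro v a
    simp only [map_zero, zero_apply, and_self]
  · intro v a
    simp only [map_zero, zero_apply, and_self]
  · filter_upwards [LCK.eventually_chartInduced_eq A hφ.contMDiff_φ p,
      eventually_mem_source hφ.contMDiff_φ p] with u hu hu' a b
    rw [hu]
    refine (hφ.inducedForm_apply _ _ _).trans ?_
    have aux : ∀ (z : M₁ × M₂) (w₁ : M₁) (w₂ : M₂), z = (w₁, w₂) → ∀ (a' b' : E₁ × E₂)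
      (a₁ b₁ : E₁) (a₂ b₂ : E₂), a' = (a₁, a₂) → b' = (b₁, b₂) →
      g₁.inner z.1 a'.1 b'.1 + lam z.1 ^ 2 * g₂.inner z.2 a'.2 b'.2 =
        g₁.inner w₁ a₁ b₁ + lam w₁ ^ 2 * g₂.inner w₂ a₂ b₂ := by
      rintro _ _ _ rfl _ _ _ _ _ _ rfl rfl
      rfl
    exact aux _ _ _ (extChartAt_prod_symm_apply p u) _ _ _ _ _ _ (chartSymmDeriv_prod hu'.1 a)
      (chartSymmDeriv_prod hu'.1 b)

theorem eventually_exists_D₁ (hφ : IsWarpedProductImmersion A g₁ g₂ lam φ)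
    (hθ : IsPointwiseBiSlant (E₁ := E₁) (E₂ := E₂) A φ θ₁ θ₂) (p : M₁ × M₂) :
    ∀ᶠ u in 𝓝 (extChartAt (𝓘(ℝ, E₁).prod 𝓘(ℝ, E₂)) p p), ∀ x : E₁ × E₂, x ∈ D₁ E₁ M₁ E₂ M₂ p →
      ∃ s : E₁ × E₂, s ∈ D₁ E₁ M₁ E₂ M₂ p ∧
        (∀ y, chartTwoForm (I := 𝓘(ℝ, E₁).prod 𝓘(ℝ, E₂)) A φ p u x y =
          chartInduced (I := 𝓘(ℝ, E₁).prod 𝓘(ℝ, E₂)) A φ p u s y) ∧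
        chartInduced (I := 𝓘(ℝ, E₁).prod 𝓘(ℝ, E₂)) A φ p u s s =
          Real.cos (θ₁ ((extChartAt 𝓘(ℝ, E₁) p.1).symm u.1)) ^ 2 *
            chartInduced (I := 𝓘(ℝ, E₁).prod 𝓘(ℝ, E₂)) A φ p u x x := by
  filter_upwards [eventually_chartInduced_eq A hφ.contMDiff_φ p,
    eventually_chartTwoForm_eq A hφ.contMDiff_φ p, eventually_mem_source hφ.contMDiff_φ p]
    with u hm hΩ hu x hx
  obtain ⟨s, hs, hs₁, hs₂⟩ := exists_chartTwoForm_eq hu.1 hm hΩ (hφ.isInnerProduct _)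
    (chartSymmDeriv_mem_D₁ hu.1) (P_mem_D₁ hφ hθ _) hx
  refine ⟨s, hs, hs₁, ?_⟩
  have h := hs₂ _ (hθ.slant₁ _)
  rwa [congrArg Prod.fst (extChartAt_prod_symm_apply p u)] at h

theorem eventually_exists_D₂ (hφ : IsWarpedProductImmersion A g₁ g₂ lam φ)
    (hθ : IsPointwiseBiSlant (E₁ := E₁) (E₂ := E₂) A φ θ₁ θ₂) (p : M₁ × M₂) :
    ∀ᶠ u in 𝓝 (extChartAt (𝓘(ℝ, E₁).prod 𝓘(ℝ, E₂)) p p), ∀ x : E₁ × E₂, x ∈ D₂ E₁ M₁ E₂ M₂ p →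
      ∃ s : E₁ × E₂, s ∈ D₂ E₁ M₁ E₂ M₂ p ∧
        (∀ y, chartTwoForm (I := 𝓘(ℝ, E₁).prod 𝓘(ℝ, E₂)) A φ p u x y =
          chartInduced (I := 𝓘(ℝ, E₁).prod 𝓘(ℝ, E₂)) A φ p u s y) ∧
        chartInduced (I := 𝓘(ℝ, E₁).prod 𝓘(ℝ, E₂)) A φ p u s s =
          Real.cos (θ₂ ((extChartAt 𝓘(ℝ, E₂) p.2).symm u.2)) ^ 2 *
            chartInduced (I := 𝓘(ℝ, E₁).prod 𝓘(ℝ, E₂)) A φ p u x x := by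
  filter_upwards [eventually_chartInduced_eq A hφ.contMDiff_φ p,
    eventually_chartTwoForm_eq A hφ.contMDiff_φ p, eventually_mem_source hφ.contMDiff_φ p]
    with u hm hΩ hu x hx
  obtain ⟨s, hs, hs₁, hs₂⟩ := exists_chartTwoForm_eq hu.1 hm hΩ (hφ.isInnerProduct _)
    (chartSymmDeriv_mem_D₂ hu.1) (P_mem_D₂ hφ hθ _) hx
  refine ⟨s, hs, hs₁, ?_⟩
  have h := hs₂ _ (hθ.slant₂ _)
  rwa [congrArg Prod.snd (extChartAt_prod_symm_apply p u)] at h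

/-- Moving along the second factor changes neither `g₁` nor `θ₁`, so the scaling is `ρ = 1` and `κ =
0`. -/
theorem codazzi_D₁ {lee : ∀ x : N, TangentSpace 𝓘(ℝ, E) x →L[ℝ] ℝ}
    (hA : IsLCK A lee) (hφ : IsWarpedProductImmersion A g₁ g₂ lam φ)
    (hθ : IsPointwiseBiSlant (E₁ := E₁) (E₂ := E₂) A φ θ₁ θ₂) (p : M₁ × M₂) :
    ∀ x ∈ D₁ E₁ M₁ E₂ M₂ p, ∀ y ∈ D₁ E₁ M₁ E₂ M₂ p, ∀ z ∈ D₂ E₁ M₁ E₂ M₂ p,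
      A.form (φ p) (sff (𝓘(ℝ, E₁).prod 𝓘(ℝ, E₂)) A φ p x y) (F (𝓘(ℝ, E₁).prod 𝓘(ℝ, E₂)) A φ p z) +
        1 / 2 * inducedForm (𝓘(ℝ, E₁).prod 𝓘(ℝ, E₂)) A φ p x y *
          A.form (φ p) (leeField A lee (φ p)) (F (𝓘(ℝ, E₁).prod 𝓘(ℝ, E₂)) A φ p z) =
      A.form (φ p) (sff (𝓘(ℝ, E₁).prod 𝓘(ℝ, E₂)) A φ p x z)
        (F (𝓘(ℝ, E₁).prod 𝓘(ℝ, E₂)) A φ p y) := by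
  obtain ⟨G₁, G₂, hG₁, hG₂, hG⟩ := hφ.eventually_chartInduced_eq p
  have hE := eventually_exists_D₁ hφ hθ p
  have hm : ∀ᶠ u in 𝓝 (extChartAt (𝓘(ℝ, E₁).prod 𝓘(ℝ, E₂)) p p),
      ∀ x ∈ D₁ E₁ M₁ E₂ M₂ p, ∀ z ∈ D₂ E₁ M₁ E₂ M₂ p,
        chartInduced (I := 𝓘(ℝ, E₁).prod 𝓘(ℝ, E₂)) A φ p u x z = 0 := by
    filter_upwards [hG] with u hu
    intro (x : E₁ × E₂) hx (z : E₁ × E₂) hz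
    have hx₂ : x.2 = 0 := (mem_D₁ (E₁ := E₁) (E₂ := E₂)).1 hx
    have hz₁ : z.1 = 0 := (mem_D₂ (E₁ := E₁) (E₂ := E₂)).1 hz
    rw [hu, hx₂, hz₁, (hG₁ _ _).2, (hG₂ _ _).1]
    simp
  refine codazzi hA hφ.contMDiff_φ (hφ.isInnerProduct p) (hφ.orthogonal p) (P_mem_D₁ hφ hθ p)
    (P_mem_D₂ hφ hθ p) hm ?_ (pow_pos (hθ.cos_θ₁_pos p.1) 2).ne' (hθ.slant₁ p) (κ := fun _ => 0) ?_
  · filter_upwards [hm, hE] with u hu hu' x hx z hz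
    obtain ⟨s, hs, hs₁, -⟩ := hu' x hx
    exact (hs₁ z).trans (hu s hs z hz)
  · intro (z : E₁ × E₂) hz
    have hz₁ : z.1 = 0 := (mem_D₂ (E₁ := E₁) (E₂ := E₂)).1 hz
    refine ⟨fun _ => 1, by simpa using hasDerivAt_const (0 : ℝ) (1 : ℝ), rfl, ?_⟩
    have hl : Filter.Tendsto (fun t : ℝ => extChartAt (𝓘(ℝ, E₁).prod 𝓘(ℝ, E₂)) p p + t • z) (𝓝 0)
        (𝓝 (extChartAt (𝓘(ℝ, E₁).prod 𝓘(ℝ, E₂)) p p)) :=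
      (Continuous.tendsto' (by fun_prop) _ _ (by simp))
    have h₁ : ∀ t : ℝ, (extChartAt (𝓘(ℝ, E₁).prod 𝓘(ℝ, E₂)) p p + t • z).1 =
        (extChartAt (𝓘(ℝ, E₁).prod 𝓘(ℝ, E₂)) p p).1 := by
      intro t
      rw [Prod.fst_add, Prod.smul_fst, hz₁, smul_zero, add_zero]
    filter_upwards [hl.eventually hG, hl.eventually hE] with t ht ht'
    intro (x : E₁ × E₂) hx
    have hx₂ : x.2 = 0 := (mem_D₁ (E₁ := E₁) (E₂ := E₂)).1 hx
    refine ⟨fun (y : E₁ × E₂) hy => ?_, ?_⟩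
    · have h := hG.self_of_nhds x y
      rw [chartInduced_extChartAt hφ.contMDiff_φ] at h
      rw [ht, h₁, one_mul]
      refine Eq.trans ?_ h.symm
      rw [hx₂, (hG₂ _ _).1, (hG₂ _ _).1, mul_zero]
    · obtain ⟨s, hs, hs₁, hs₂⟩ := ht' x hx
      refine ⟨s, hs, fun y _ => hs₁ y, ?_⟩
      rw [h₁] at hs₂
      have hp₁ : (extChartAt 𝓘(ℝ, E₁) p.1).symm (extChartAt (𝓘(ℝ, E₁).prod 𝓘(ℝ, E₂)) p p).1 = p.1 :=
        extChartAt_to_inv (I := 𝓘(ℝ, E₁)) p.1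
      rwa [hp₁] at hs₂

/-- Moving along the first factor fixes `g₂` and `θ₂` but multiplies the metric on the second factor
by the change of `λ²`. Thus `ρ = λ² / λ(p)²` and `κ = d log λ`. -/
theorem codazzi_D₂ {lee : ∀ x : N, TangentSpace 𝓘(ℝ, E) x →L[ℝ] ℝ}
    (hA : IsLCK A lee) (hφ : IsWarpedProductImmersion A g₁ g₂ lam φ)
    (hθ : IsPointwiseBiSlant (E₁ := E₁) (E₂ := E₂) A φ θ₁ θ₂) (p : M₁ × M₂) :
    ∀ x ∈ D₂ E₁ M₁ E₂ M₂ p, ∀ y ∈ D₂ E₁ M₁ E₂ M₂ p, ∀ z ∈ D₁ E₁ M₁ E₂ M₂ p,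
      A.form (φ p) (sff (𝓘(ℝ, E₁).prod 𝓘(ℝ, E₂)) A φ p x y) (F (𝓘(ℝ, E₁).prod 𝓘(ℝ, E₂)) A φ p z) +
        1 / 2 * inducedForm (𝓘(ℝ, E₁).prod 𝓘(ℝ, E₂)) A φ p x y *
          A.form (φ p) (leeField A lee (φ p)) (F (𝓘(ℝ, E₁).prod 𝓘(ℝ, E₂)) A φ p z) =
      A.form (φ p) (sff (𝓘(ℝ, E₁).prod 𝓘(ℝ, E₂)) A φ p x z)
        (F (𝓘(ℝ, E₁).prod 𝓘(ℝ, E₂)) A φ p y) := by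
  obtain ⟨G₁, G₂, hG₁, hG₂, hG⟩ := hφ.eventually_chartInduced_eq p
  have hE := eventually_exists_D₂ hφ hθ p
  have hm : ∀ᶠ u in 𝓝 (extChartAt (𝓘(ℝ, E₁).prod 𝓘(ℝ, E₂)) p p),
      ∀ x ∈ D₂ E₁ M₁ E₂ M₂ p, ∀ z ∈ D₁ E₁ M₁ E₂ M₂ p,
        chartInduced (I := 𝓘(ℝ, E₁).prod 𝓘(ℝ, E₂)) A φ p u x z = 0 := by
    filter_upwards [hG] with u hu
    intro (x : E₁ × E₂) hx (z : E₁ × E₂) hz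
    have hx₁ : x.1 = 0 := (mem_D₂ (E₁ := E₁) (E₂ := E₂)).1 hx
    have hz₂ : z.2 = 0 := (mem_D₁ (E₁ := E₁) (E₂ := E₂)).1 hz
    rw [hu, hx₁, hz₂, (hG₁ _ _).1, (hG₂ _ _).2]
    simp
  have hlam : DifferentiableAt ℝ (fun v => lam ((extChartAt 𝓘(ℝ, E₁) p.1).symm v))
      (extChartAt 𝓘(ℝ, E₁) p.1 p.1) :=
    differentiableAt_comp_extChartAt_symm (hφ.contMDiff_lam p.1)
  have hp₁ : lam ((extChartAt 𝓘(ℝ, E₁) p.1).symm (extChartAt 𝓘(ℝ, E₁) p.1 p.1)) = lam p.1 := by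
    rw [extChartAt_to_inv]
  have hp₁' := (hφ.lam_pos p.1).ne'
  refine codazzi hA hφ.contMDiff_φ (hφ.isInnerProduct p)
    (fun x hx z hz => ((hφ.isInnerProduct p).1 x z).trans (hφ.orthogonal p z hz x hx))
    (P_mem_D₂ hφ hθ p) (P_mem_D₁ hφ hθ p) hm ?_ (pow_pos (hθ.cos_θ₂_pos p.2) 2).ne' (hθ.slant₂ p)
    (κ := fun (z : E₁ × E₂) => fderiv ℝ (fun v => lam ((extChartAt 𝓘(ℝ, E₁) p.1).symm v))
      (extChartAt 𝓘(ℝ, E₁) p.1 p.1) z.1 / lam p.1) ?_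
  · filter_upwards [hm, hE] with u hu hu' x hx z hz
    obtain ⟨s, hs, hs₁, -⟩ := hu' x hx
    exact (hs₁ z).trans (hu s hs z hz)
  · intro (z : E₁ × E₂) hz
    have hz₂ : z.2 = 0 := (mem_D₁ (E₁ := E₁) (E₂ := E₂)).1 hz
    have hline : HasDerivAt (fun t : ℝ => extChartAt 𝓘(ℝ, E₁) p.1 p.1 + t • z.1) z.1 0 := by
      simpa using ((hasDerivAt_id (0 : ℝ)).smul_const z.1).const_add (extChartAt 𝓘(ℝ, E₁) p.1 p.1)
    have hd := ((hlam.hasFDerivAt.comp_hasDerivAt_of_eq 0 hline (by simp)).pow 2).div_const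
      (lam p.1 ^ 2)
    refine ⟨fun t => lam ((extChartAt 𝓘(ℝ, E₁) p.1).symm
      (extChartAt 𝓘(ℝ, E₁) p.1 p.1 + t • z.1)) ^ 2 / lam p.1 ^ 2, ?_, ?_, ?_⟩
    · refine hd.congr_deriv ?_
      simp only [Function.comp_apply, zero_smul, add_zero, hp₁]
      field_simp
      norm_num
      ring
    · simp only [zero_smul, add_zero, hp₁]
      exact div_self (pow_ne_zero 2 hp₁')
    have hl : Filter.Tendsto (fun t : ℝ => extChartAt (𝓘(ℝ, E₁).prod 𝓘(ℝ, E₂)) p p + t • z) (𝓝 0)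
        (𝓝 (extChartAt (𝓘(ℝ, E₁).prod 𝓘(ℝ, E₂)) p p)) :=
      (Continuous.tendsto' (by fun_prop) _ _ (by simp))
    have h₂ : ∀ t : ℝ, (extChartAt (𝓘(ℝ, E₁).prod 𝓘(ℝ, E₂)) p p + t • z).2 =
        (extChartAt (𝓘(ℝ, E₁).prod 𝓘(ℝ, E₂)) p p).2 := by
      intro t
      rw [Prod.snd_add, Prod.smul_snd, hz₂, smul_zero, add_zero]
    filter_upwards [hl.eventually hG, hl.eventually hE] with t ht ht'
    intro (x : E₁ × E₂) hx
    have hx₁ : x.1 = 0 := (mem_D₂ (E₁ := E₁) (E₂ := E₂)).1 hx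
    refine ⟨fun (y : E₁ × E₂) hy => ?_, ?_⟩
    · have h := hG.self_of_nhds x y
      rw [chartInduced_extChartAt hφ.contMDiff_φ] at h
      have h₁ : lam ((extChartAt 𝓘(ℝ, E₁) p.1).symm
        (extChartAt (𝓘(ℝ, E₁).prod 𝓘(ℝ, E₂)) p p).1) = lam p.1 := hp₁
      rw [hx₁, (hG₁ _ _).1, zero_add, h₁] at h
      rw [ht, h₂, hx₁, (hG₁ _ _).1, zero_add]
      refine Eq.trans ?_ (congrArg (_ * ·) h.symm)
      have h₃ : (extChartAt (𝓘(ℝ, E₁).prod 𝓘(ℝ, E₂)) p p + t • z).1 =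
        extChartAt 𝓘(ℝ, E₁) p.1 p.1 + t • z.1 := rfl
      rw [h₃]
      field_simp
    · obtain ⟨s, hs, hs₁, hs₂⟩ := ht' x hx
      refine ⟨s, hs, fun y _ => hs₁ y, ?_⟩
      rw [h₂] at hs₂
      have hp₂ : (extChartAt 𝓘(ℝ, E₂) p.2).symm (extChartAt (𝓘(ℝ, E₁).prod 𝓘(ℝ, E₂)) p p).2 = p.2 :=
        extChartAt_to_inv (I := 𝓘(ℝ, E₂)) p.2
      rwa [hp₂] at hs₂

end Warped

/-! ### Assembly of the estimate -/

section Warped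

variable {E : Type*} [NormedAddCommGroup E] [NormedSpace ℝ E] [FiniteDimensional ℝ E]
  {N : Type*} [TopologicalSpace N] [ChartedSpace E N] [IsManifold 𝓘(ℝ, E) ∞ N]
  {E₁ : Type*} [NormedAddCommGroup E₁] [NormedSpace ℝ E₁] [FiniteDimensional ℝ E₁]
  {M₁ : Type*} [TopologicalSpace M₁] [ChartedSpace E₁ M₁] [IsManifold 𝓘(ℝ, E₁) ∞ M₁]
  {E₂ : Type*} [NormedAddCommGroup E₂] [NormedSpace ℝ E₂] [FiniteDimensional ℝ E₂]
  {M₂ : Type*} [TopologicalSpace M₂] [ChartedSpace E₂ M₂] [IsManifold 𝓘(ℝ, E₂) ∞ M₂]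
  {A : HermitianStructure E N}
  {g₁ : Bundle.ContMDiffRiemannianMetric 𝓘(ℝ, E₁) ∞ E₁ (TangentSpace 𝓘(ℝ, E₁) : M₁ → Type _)}
  {g₂ : Bundle.ContMDiffRiemannianMetric 𝓘(ℝ, E₂) ∞ E₂ (TangentSpace 𝓘(ℝ, E₂) : M₂ → Type _)}
  {lam : M₁ → ℝ} {φ : M₁ × M₂ → N} {θ₁ : M₁ → ℝ} {θ₂ : M₂ → ℝ}

theorem sin_mem_Ioo {θ : ℝ} (hθ : θ ∈ Ioo 0 (Real.pi / 2)) : Real.sin θ ∈ Ioo (0 : ℝ) 1 := by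
  have hπ := Real.pi_pos
  refine ⟨Real.sin_pos_of_pos_of_lt_pi hθ.1 (by linarith [hθ.2]), ?_⟩
  rw [← Real.sin_pi_div_two]
  exact Real.sin_lt_sin_of_lt_of_le_pi_div_two (by linarith [hθ.1]) le_rfl hθ.2

theorem lowerBound_le {lee : ∀ x : N, TangentSpace 𝓘(ℝ, E) x →L[ℝ] ℝ}
    (hA : IsLCK A lee) (hφ : IsWarpedProductImmersion A g₁ g₂ lam φ)
    (hθ : IsPointwiseBiSlant (E₁ := E₁) (E₂ := E₂) A φ θ₁ θ₂)
    {n₁ n₂ : ℕ} (hn₁ : finrank ℝ E₁ = 2 * n₁) (hn₂ : finrank ℝ E₂ = 2 * n₂) (p : M₁ × M₂) :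
    lowerBound E₁ E₂ A lee φ θ₁ θ₂ n₁ n₂ p ≤ sffNormSq (𝓘(ℝ, E₁).prod 𝓘(ℝ, E₂)) A φ p ∧
      (sffNormSq (𝓘(ℝ, E₁).prod 𝓘(ℝ, E₂)) A φ p = lowerBound E₁ E₂ A lee φ θ₁ θ₂ n₁ n₂ p →
        ∀ u v : TangentSpace (𝓘(ℝ, E₁).prod 𝓘(ℝ, E₂)) p,
          sff (𝓘(ℝ, E₁).prod 𝓘(ℝ, E₂)) A φ p u v = 0) := by
  have hp := hφ.isInnerProduct p
  have h₁ := sin_mem_Ioo (hθ.θ₁_mem p.1)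
  have h₂ := sin_mem_Ioo (hθ.θ₂_mem p.2)
  refine estimate hp (A.isInnerProduct_form (φ p)) (D₁_sup_D₂ p) (hφ.orthogonal p) (Fₗ A hp)
    (sffₗ A hφ.contMDiff_φ hp) (fun u v => ?_) (leeField A lee (φ p)) h₁.1 h₂.1 h₁.2 h₂.2
    (fun x hx y _ => ?_) (fun x hx y _ => ?_) (fun x hx y hy => ?_) (codazzi_D₁ hA hφ hθ p)
    (codazzi_D₂ hA hφ hθ p) ((finrank_D₁ p).trans hn₁) ((finrank_D₂ p).trans hn₂)
  · exact congrArg (normalPart _ A φ p) (covDeriv_comm A hφ.contMDiff_φ p u v)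
  · refine (form_F_F hp x y).trans ?_
    rw [inducedForm_P_P hp (hθ.slant₁ p x hx), Real.sin_sq]
    ring
  · refine (form_F_F hp x y).trans ?_
    rw [inducedForm_P_P hp (hθ.slant₂ p x hx), Real.sin_sq]
    ring
  · refine (form_F_F hp x y).trans ?_
    rw [hφ.orthogonal p x hx y hy, hφ.orthogonal p _ (P_mem_D₁ hφ hθ p x hx) _
      (P_mem_D₂ hφ hθ p y hy), sub_zero]

end Warped

end LCK

theorem mainTheorem2
    {E : Type*} [NormedAddCommGroup E] [NormedSpace ℝ E] [FiniteDimensional ℝ E]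
    {N : Type*} [TopologicalSpace N] [ChartedSpace E N] [IsManifold 𝓘(ℝ, E) ∞ N]
    {E₁ : Type*} [NormedAddCommGroup E₁] [NormedSpace ℝ E₁] [FiniteDimensional ℝ E₁]
    {M₁ : Type*} [TopologicalSpace M₁] [ChartedSpace E₁ M₁] [IsManifold 𝓘(ℝ, E₁) ∞ M₁]
    {E₂ : Type*} [NormedAddCommGroup E₂] [NormedSpace ℝ E₂] [FiniteDimensional ℝ E₂]
    {M₂ : Type*} [TopologicalSpace M₂] [ChartedSpace E₂ M₂] [IsManifold 𝓘(ℝ, E₂) ∞ M₂]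
    (A : LCK.HermitianStructure E N) (lee : ∀ x : N, TangentSpace 𝓘(ℝ, E) x →L[ℝ] ℝ)
    (hA : LCK.IsLCK A lee)
    (g₁ : Bundle.ContMDiffRiemannianMetric 𝓘(ℝ, E₁) ∞ E₁ (TangentSpace 𝓘(ℝ, E₁) : M₁ → Type _))
    (g₂ : Bundle.ContMDiffRiemannianMetric 𝓘(ℝ, E₂) ∞ E₂ (TangentSpace 𝓘(ℝ, E₂) : M₂ → Type _))
    (lam : M₁ → ℝ) (φ : M₁ × M₂ → N) (θ₁ : M₁ → ℝ) (θ₂ : M₂ → ℝ)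
    (hφ : LCK.IsWarpedProductImmersion A g₁ g₂ lam φ)
    (hθ : LCK.IsPointwiseBiSlant (E₁ := E₁) (E₂ := E₂) A φ θ₁ θ₂)
    (n₁ n₂ : ℕ) (hn₁ : Module.finrank ℝ E₁ = 2 * n₁) (hn₂ : Module.finrank ℝ E₂ = 2 * n₂) :
    (∀ p : M₁ × M₂, LCK.lowerBound E₁ E₂ A lee φ θ₁ θ₂ n₁ n₂ p
      ≤ LCK.sffNormSq (𝓘(ℝ, E₁).prod 𝓘(ℝ, E₂)) A φ p) ∧
    (∀ p : M₁ × M₂, LCK.sffNormSq (𝓘(ℝ, E₁).prod 𝓘(ℝ, E₂)) A φ p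
        = LCK.lowerBound E₁ E₂ A lee φ θ₁ θ₂ n₁ n₂ p →
      ∀ u v : TangentSpace (𝓘(ℝ, E₁).prod 𝓘(ℝ, E₂)) p,
        LCK.sff (𝓘(ℝ, E₁).prod 𝓘(ℝ, E₂)) A φ p u v
          ∈ LCK.FD₁ E₁ E₂ A φ p ⊔ LCK.FD₂ E₁ E₂ A φ p) ∧
    ((∀ p : M₁ × M₂, LCK.sffNormSq (𝓘(ℝ, E₁).prod 𝓘(ℝ, E₂)) A φ p
        = LCK.lowerBound E₁ E₂ A lee φ θ₁ θ₂ n₁ n₂ p) →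
      (LCK.IsMinimal (𝓘(ℝ, E₁).prod 𝓘(ℝ, E₂)) A φ ↔
        LCK.IsMixedTotallyGeodesic E₁ E₂ A φ)) := by
  have hest : ∀ p : M₁ × M₂, LCK.lowerBound E₁ E₂ A lee φ θ₁ θ₂ n₁ n₂ p
      ≤ LCK.sffNormSq (𝓘(ℝ, E₁).prod 𝓘(ℝ, E₂)) A φ p ∧
      (LCK.sffNormSq (𝓘(ℝ, E₁).prod 𝓘(ℝ, E₂)) A φ p
        = LCK.lowerBound E₁ E₂ A lee φ θ₁ θ₂ n₁ n₂ p →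
      ∀ u v : TangentSpace (𝓘(ℝ, E₁).prod 𝓘(ℝ, E₂)) p,
        LCK.sff (𝓘(ℝ, E₁).prod 𝓘(ℝ, E₂)) A φ p u v = 0) :=
    fun p => LCK.lowerBound_le hA hφ hθ hn₁ hn₂ p
  refine ⟨fun p => (hest p).1, fun p h u v => ?_, fun h => ?_⟩
  -- Equality already makes `h` vanish at the point, so the inclusion is that of the zero vector.
  · rw [(hest p).2 h u v]
    exact Submodule.zero_mem _
  -- With equality everywhere `h` vanishes identically, and both sides of the equivalence hold.
  · refine iff_of_true (fun p => ?_) fun p u _ v _ => (hest p).2 (h p) u v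
    unfold LCK.meanCurvatureOn LCK.traceOn
    exact Finset.sum_eq_zero fun k _ => (hest p).2 (h p) _ _
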